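/- All manifolds are smooth and finite-dimensional. Let $M$ be a Hausdorff manifold and let $$K\xrightarrow{\ j\ }G\xrightarrow{\ \pi\ }E$$ be an extension of Lie groupoids over $M$: $K$ is a bundle of Lie groups (a Lie groupoid whose source and target maps coincide), $G$ is a Lie groupoid, $E$ is a foliation groupoid (the fibres of $(s,t):E\to M\times M$ are discrete), $j$ and $\pi$ are homomorphisms over the identity of $M$, $j$ is an embedding, $\pi$ is a surjective submersion, and $j(K)$ is the set of arrows which $\pi$ sends to units. (The manifolds of arrows need not be Hausdorff.) Let $T\subset M$ be a complete transversal to the orbit foliation of $G$, i.e. a submanifold everywhere complementary to the leaves and meeting every leaf; write $G_T=\{g\in G\mid s(g),t(g)\in T\}$, and let $K_T$ be the restriction of $K$ to $T$. Let $L$ be a bundle of Lie groups over $M$ and let $P$ be an $L$-$K$ bitorsor over $M$, i.e. a manifold with a surjective submersion to $M$ and commuting structures of left $L$-torsor and right $K$-torsor. Let $P\otimes_K G\otimes_K P^{-1}$ be the twisted groupoid: its arrows $x\to y$ are the classes $q\otimes g\otimes p^{-1}$ of triples with $q\in P_y$, $g:x\to y$ in $G$, $p\in P_x$, under the equivalence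 relation generated by $(qk,g,p^{-1})\sim(q,kg,p^{-1})$ and $(q,gl,p^{-1})\sim(q,g,lp^{-1})$ for $k\in K_y$, $l\in K_x$, where $lp^{-1}=(pl^{-1})^{-1}$; the composition is $(r\otimes h\otimes s^{-1})(q\otimes g\otimes p^{-1})=r\otimes h(s^{-1}q)g\otimes p^{-1}$, where $s^{-1}q\in K$ is determined by $s\cdot(s^{-1}q)=q$. It sits in the extension $$L\xrightarrow{\ j_P\ }P\otimes_K G\otimes_K P^{-1}\xrightarrow{\ \pi_P\ }E,$$ where $j_P(l)=lq\otimes 1_x\otimes q^{-1}$ for $l\in L_x$ and any $q\in P_x$, and $\pi_P(q\otimes g\otimes p^{-1})=\pi(g)$. For a smooth section $\alpha$ of $P$ over $T$ (or over $M$) let $\overline{\alpha}(k)=\alpha(x)k\alpha(x)^{-1}\in L_x$ for $k\in K_x$, i.e. $\alpha(x)k=\overline\alpha(k)\alpha(x)$, and let $\hat\alpha(g)=\alpha(y)\otimes g\otimes\alpha(x)^{-1}$ for $g:x\to y$ in $G_T$ (respectively in $G$). If $L=K$, call $\alpha$ central if $\overline\alpha$ is the identity. An isomorphism of extensions from $K\to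 G\to E$ to $L\to P\otimes_KG\otimes_KP^{-1}\to E$ is a pair $(v,u)$ of isomorphisms of Lie groupoids $v:K\to L$ and $u:G\to P\otimes_KG\otimes_KP^{-1}$ over the identity of $M$ such that $uj=j_Pv$ and $\pi_Pu=\pi$. **Proposition 4.5.** Let $\alpha$ be a smooth section over $T$ of the $L$-$K$ bitorsor $P$. (i) For every smooth section $\beta$ of $P$ over $M$ which extends $\alpha$, the pair $(\overline\beta,\hat\beta)$ is an isomorphism of extensions, and it restricts to $(\overline\alpha,\hat\alpha)$ over $T$. (ii) Conversely, if $(v,u)$ is an isomorphism of extensions such that $u$ restricts to $\hat\alpha$ on $G_T$, then there is a unique smooth section $\beta$ of $P$ over $M$ which extends $\alpha$ and satisfies $u=\hat\beta$ and $v=\overline\beta$. (iii) In particular, if $L=K$ and $v$ is the identity in (ii), then $\beta$ is central whenever $\alpha$ is. -/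

import Mathlib

open Set Topology
open scoped Manifold ContDiff

namespace LieExt

/-! ### Lie groupoids and bundles of Lie groups -/

/-- The structure maps of a groupoid with objects `M` and arrows `G`.  The composite
`mul g h` is meaningful only when `src g = tgt h`; other values of `mul` are irrelevant. -/
structure GroupoidData (M G : Type*) where
  src : G → M
  tgt : G → M
  mul : G → G → G
  inv : G → G
  unit : M → G

/-- A homomorphism of groupoids which is the identity on objects. -/
structure GroupoidData.IsHom {M G H : Type*} (𝒢 : GroupoidData M G) (ℋ : GroupoidData M H)
    (f : G → H) : Prop where
  map_src : ∀ g, ℋ.src (f g) = 𝒢.src g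
  map_tgt : ∀ g, ℋ.tgt (f g) = 𝒢.tgt g
  map_mul : ∀ g h, 𝒢.src g = 𝒢.tgt h → f (𝒢.mul g h) = ℋ.mul (f g) (f h)
  map_inv : ∀ g, f (𝒢.inv g) = ℋ.inv (f g)
  map_unit : ∀ x, f (𝒢.unit x) = ℋ.unit x

/-- A Lie groupoid of dimension `d` over the `n`-dimensional manifold `M`.
`G` need not be Hausdorff.  Smoothness of the composition is smoothness on the embedded
submanifold of composable pairs. -/
structure LieGroupoid (n d : ℕ) (M G : Type*)
    [TopologicalSpace M] [ChartedSpace (EuclideanSpace ℝ (Fin n)) M]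
    [TopologicalSpace G] [ChartedSpace (EuclideanSpace ℝ (Fin d)) G]
    extends GroupoidData M G where
  isSubmersion_src : Manifold.IsSubmersion (𝓡 d) (𝓡 n) ∞ src
  isSubmersion_tgt : Manifold.IsSubmersion (𝓡 d) (𝓡 n) ∞ tgt
  contMDiffOn_mul : ContMDiffOn ((𝓡 d).prod (𝓡 d)) (𝓡 d) ∞ (fun a : G × G => mul a.1 a.2)
    {a : G × G | src a.1 = tgt a.2}
  contMDiff_inv : ContMDiff (𝓡 d) (𝓡 d) ∞ inv
  contMDiff_unit : ContMDiff (𝓡 n) (𝓡 d) ∞ unit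
  src_mul : ∀ g h, src g = tgt h → src (mul g h) = src h
  tgt_mul : ∀ g h, src g = tgt h → tgt (mul g h) = tgt g
  mul_assoc : ∀ g h k, src g = tgt h → src h = tgt k → mul (mul g h) k = mul g (mul h k)
  src_unit : ∀ x, src (unit x) = x
  tgt_unit : ∀ x, tgt (unit x) = x
  mul_unit : ∀ g, mul g (unit (src g)) = g
  unit_mul : ∀ g, mul (unit (tgt g)) g = g
  src_inv : ∀ g, src (inv g) = tgt g
  tgt_inv : ∀ g, tgt (inv g) = src g
  mul_inv : ∀ g, mul g (inv g) = unit (tgt g)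
  inv_mul : ∀ g, mul (inv g) g = unit (src g)

/-- A bundle of Lie groups: a Lie groupoid whose source and target maps coincide. -/
structure LieGroupBundle (n d : ℕ) (M K : Type*)
    [TopologicalSpace M] [ChartedSpace (EuclideanSpace ℝ (Fin n)) M]
    [TopologicalSpace K] [ChartedSpace (EuclideanSpace ℝ (Fin d)) K]
    extends LieGroupoid n d M K where
  tgt_eq_src : ∀ k, tgt k = src k

section Foliation

variable {n d : ℕ} {M G : Type*}
  [TopologicalSpace M] [ChartedSpace (EuclideanSpace ℝ (Fin n)) M]
  [TopologicalSpace G] [ChartedSpace (EuclideanSpace ℝ (Fin d)) G]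

/-- A foliation groupoid: the fibres of `(s,t) : G → M × M` are discrete. -/
def LieGroupoid.IsFoliation (𝒢 : LieGroupoid n d M G) : Prop :=
  ∀ x y : M, DiscreteTopology {g : G | 𝒢.src g = x ∧ 𝒢.tgt g = y}

/-- The tangent space at `x` to the orbit foliation: the image of the anchor map, i.e. of
`dt : ker ds → TM` at the unit arrow `1_x`. -/
noncomputable def LieGroupoid.orbitTangent (𝒢 : LieGroupoid n d M G) (x : M) :
    Submodule ℝ (TangentSpace (𝓡 n) x) :=
  Submodule.map (mfderiv (𝓡 d) (𝓡 n) 𝒢.tgt (𝒢.unit x)).toLinearMap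
    (LinearMap.ker (mfderiv (𝓡 d) (𝓡 n) 𝒢.src (𝒢.unit x)).toLinearMap)

/-- The leaf through `x` of the orbit foliation: the connected component of `x` in its orbit
`t(s⁻¹(x))`, the orbit being topologized as the quotient of `s⁻¹(x)` under `t`.  As `t` is open
onto the orbit for that topology, this is the image of the component of `1_x` in `s⁻¹(x)`. -/
def LieGroupoid.leaf (𝒢 : LieGroupoid n d M G) (x : M) : Set M :=
  𝒢.tgt '' connectedComponentIn {g : G | 𝒢.src g = x} (𝒢.unit x)

/-- `T`, with its inclusion `ι : T → M`, is a complete transversal to the orbit foliation: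
an (injectively immersed, for instance embedded) submanifold, everywhere complementary to the
leaves, which meets every leaf. -/
structure IsCompleteTransversal (q : ℕ) {T : Type*} [TopologicalSpace T]
    [ChartedSpace (EuclideanSpace ℝ (Fin q)) T] (𝒢 : LieGroupoid n d M G) (ι : T → M) : Prop where
  injective : Function.Injective ι
  isImmersion : Manifold.IsImmersion (𝓡 q) (𝓡 n) ∞ ι
  isCompl : ∀ a : T,
    IsCompl (LinearMap.range (mfderiv (𝓡 q) (𝓡 n) ι a).toLinearMap) (𝒢.orbitTangent (ι a))
  meets_leaf : ∀ x : M, ∃ a : T, ι a ∈ 𝒢.leaf x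

end Foliation

/-! ### Extensions -/

/-- The maps `K → G → E` of an extension of groupoids. -/
structure ExtDiagram {M K G E : Type*} (𝒦 : GroupoidData M K) (𝒢 : GroupoidData M G)
    (ℰ : GroupoidData M E) where
  incl : K → G
  proj : G → E

/-- An extension `K → G → E` of a foliation groupoid `E` by a bundle of Lie groups `K`. -/
structure Extension {n dK dG dE : ℕ} {M K G E : Type*}
    [TopologicalSpace M] [ChartedSpace (EuclideanSpace ℝ (Fin n)) M]
    [TopologicalSpace K] [ChartedSpace (EuclideanSpace ℝ (Fin dK)) K]
    [TopologicalSpace G] [ChartedSpace (EuclideanSpace ℝ (Fin dG)) G]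
    [TopologicalSpace E] [ChartedSpace (EuclideanSpace ℝ (Fin dE)) E]
    (𝒦 : LieGroupBundle n dK M K) (𝒢 : LieGroupoid n dG M G) (ℰ : LieGroupoid n dE M E)
    extends ExtDiagram 𝒦.toGroupoidData 𝒢.toGroupoidData ℰ.toGroupoidData where
  isFoliation : ℰ.IsFoliation
  isHom_incl : 𝒦.toGroupoidData.IsHom 𝒢.toGroupoidData incl
  isHom_proj : 𝒢.toGroupoidData.IsHom ℰ.toGroupoidData proj
  isSmoothEmbedding_incl : Manifold.IsSmoothEmbedding (𝓡 dK) (𝓡 dG) ∞ incl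
  isSubmersion_proj : Manifold.IsSubmersion (𝓡 dG) (𝓡 dE) ∞ proj
  surjective_proj : Function.Surjective proj
  exact : ∀ g, (∃ x, proj g = ℰ.unit x) ↔ ∃ k, incl k = g

/-- `v : K → L` and `u : G → H` form an isomorphism of extensions
from `K → G → E` to `L → H → E` which is the identity on `E`. -/
structure IsExtIso {dK dL dG dH : ℕ} {M K L G H E : Type*}
    [TopologicalSpace K] [ChartedSpace (EuclideanSpace ℝ (Fin dK)) K]
    [TopologicalSpace L] [ChartedSpace (EuclideanSpace ℝ (Fin dL)) L]
    [TopologicalSpace G] [ChartedSpace (EuclideanSpace ℝ (Fin dG)) G]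
    [TopologicalSpace H] [ChartedSpace (EuclideanSpace ℝ (Fin dH)) H]
    {𝒦 : GroupoidData M K} {ℒ : GroupoidData M L} {𝒢 : GroupoidData M G} {ℋ : GroupoidData M H}
    {ℰ : GroupoidData M E} (X : ExtDiagram 𝒦 𝒢 ℰ) (Y : ExtDiagram ℒ ℋ ℰ)
    (v : K → L) (u : G → H) : Prop where
  diffeo_left : ∃ e : K ≃ₘ⟮𝓡 dK, 𝓡 dL⟯ L, ⇑e = v
  diffeo : ∃ e : G ≃ₘ⟮𝓡 dG, 𝓡 dH⟯ H, ⇑e = u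
  isHom_left : 𝒦.IsHom ℒ v
  isHom : 𝒢.IsHom ℋ u
  comm_incl : ∀ k, u (X.incl k) = Y.incl (v k)
  comm_proj : ∀ g, Y.proj (u g) = X.proj g

/-! ### Torsors and bitorsors -/

section Torsors

variable {n dK dL dP : ℕ} {M K L P : Type*}
  [TopologicalSpace M] [ChartedSpace (EuclideanSpace ℝ (Fin n)) M]
  [TopologicalSpace K] [ChartedSpace (EuclideanSpace ℝ (Fin dK)) K]
  [TopologicalSpace L] [ChartedSpace (EuclideanSpace ℝ (Fin dL)) L]

/-- The structure of a right `K`-torsor on `pr : P → M`: a smooth fibrewise action for which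
`(p, k) ↦ (p, p k)`, `P ×_M K → P ×_M P`, is a diffeomorphism; its inverse is
`(q, p) ↦ (q, q⁻¹p)`, where `q⁻¹p = div q p` is the division map.  As for groupoids, only the
values of `act` and `div` on the fibre products matter. -/
structure RightTorsor (dP : ℕ) (𝒦 : LieGroupBundle n dK M K) (P : Type*)
    [TopologicalSpace P] [ChartedSpace (EuclideanSpace ℝ (Fin dP)) P] (pr : P → M) where
  surjective : Function.Surjective pr
  isSubmersion : Manifold.IsSubmersion (𝓡 dP) (𝓡 n) ∞ pr
  act : P → K → P
  pr_act : ∀ p k, pr p = 𝒦.src k → pr (act p k) = pr p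
  act_unit : ∀ p, act p (𝒦.unit (pr p)) = p
  act_mul : ∀ p k l, pr p = 𝒦.src k → pr p = 𝒦.src l →
    act (act p k) l = act p (𝒦.mul k l)
  contMDiffOn_act : ContMDiffOn ((𝓡 dP).prod (𝓡 dK)) (𝓡 dP) ∞
    (fun a : P × K => act a.1 a.2) {a : P × K | pr a.1 = 𝒦.src a.2}
  div : P → P → K
  src_div : ∀ q p, pr q = pr p → 𝒦.src (div q p) = pr q
  act_div : ∀ q p, pr q = pr p → act q (div q p) = p
  div_act : ∀ p k, pr p = 𝒦.src k → div p (act p k) = k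
  contMDiffOn_div : ContMDiffOn ((𝓡 dP).prod (𝓡 dP)) (𝓡 dK) ∞
    (fun a : P × P => div a.1 a.2) {a : P × P | pr a.1 = pr a.2}

/-- The structure of a left `L`-torsor on `pr : P → M`, with action `act l p = l p` and
division map `div p q = p q⁻¹`. -/
structure LeftTorsor (dP : ℕ) (ℒ : LieGroupBundle n dL M L) (P : Type*)
    [TopologicalSpace P] [ChartedSpace (EuclideanSpace ℝ (Fin dP)) P] (pr : P → M) where
  surjective : Function.Surjective pr
  isSubmersion : Manifold.IsSubmersion (𝓡 dP) (𝓡 n) ∞ pr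
  act : L → P → P
  pr_act : ∀ l p, ℒ.src l = pr p → pr (act l p) = pr p
  unit_act : ∀ p, act (ℒ.unit (pr p)) p = p
  mul_act : ∀ l m p, ℒ.src l = pr p → ℒ.src m = pr p →
    act (ℒ.mul l m) p = act l (act m p)
  contMDiffOn_act : ContMDiffOn ((𝓡 dL).prod (𝓡 dP)) (𝓡 dP) ∞
    (fun a : L × P => act a.1 a.2) {a : L × P | ℒ.src a.1 = pr a.2}
  div : P → P → L
  src_div : ∀ p q, pr p = pr q → ℒ.src (div p q) = pr q
  div_act : ∀ p q, pr p = pr q → act (div p q) q = p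
  act_div : ∀ l p, ℒ.src l = pr p → div (act l p) p = l
  contMDiffOn_div : ContMDiffOn ((𝓡 dP).prod (𝓡 dP)) (𝓡 dL) ∞
    (fun a : P × P => div a.1 a.2) {a : P × P | pr a.1 = pr a.2}

/-- An `L`-`K` bitorsor structure on `P` over `M`. -/
structure Bitorsor (dP : ℕ) (ℒ : LieGroupBundle n dL M L) (𝒦 : LieGroupBundle n dK M K)
    (P : Type*) [TopologicalSpace P] [ChartedSpace (EuclideanSpace ℝ (Fin dP)) P] where
  pr : P → M
  left : LeftTorsor dP ℒ P pr
  right : RightTorsor dP 𝒦 P pr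
  comm : ∀ l p k, ℒ.src l = pr p → pr p = 𝒦.src k →
    left.act l (right.act p k) = right.act (left.act l p) k

end Torsors

/-! ### The twisted groupoid `P ⊗_K G ⊗_K P⁻¹` -/

namespace LieGroupoid

variable {n d : ℕ} {M G : Type*}
  [TopologicalSpace M] [ChartedSpace (EuclideanSpace ℝ (Fin n)) M]
  [TopologicalSpace G] [ChartedSpace (EuclideanSpace ℝ (Fin d)) G]

theorem inv_mul_cancel_left (𝒢 : LieGroupoid n d M G) (g h : G) (e : 𝒢.src g = 𝒢.tgt h) :
    𝒢.mul (𝒢.inv g) (𝒢.mul g h) = h := by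
  rw [← 𝒢.mul_assoc _ _ _ (𝒢.src_inv g) e, 𝒢.inv_mul, e, 𝒢.unit_mul]

theorem mul_inv_cancel_left (𝒢 : LieGroupoid n d M G) (g h : G) (e : 𝒢.tgt g = 𝒢.tgt h) :
    𝒢.mul g (𝒢.mul (𝒢.inv g) h) = h := by
  rw [← 𝒢.mul_assoc _ _ _ (𝒢.tgt_inv g).symm ((𝒢.src_inv g).trans e), 𝒢.mul_inv, e, 𝒢.unit_mul]

theorem mul_inv_cancel_right (𝒢 : LieGroupoid n d M G) (g h : G) (e : 𝒢.src g = 𝒢.tgt h) :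
    𝒢.mul (𝒢.mul g h) (𝒢.inv h) = g := by
  rw [𝒢.mul_assoc _ _ _ e (𝒢.tgt_inv h).symm, 𝒢.mul_inv, ← e, 𝒢.mul_unit]

theorem inv_mul_cancel_right (𝒢 : LieGroupoid n d M G) (g h : G) (e : 𝒢.src g = 𝒢.src h) :
    𝒢.mul (𝒢.mul g (𝒢.inv h)) h = g := by
  rw [𝒢.mul_assoc _ _ _ (e.trans (𝒢.tgt_inv h).symm) (𝒢.src_inv h), 𝒢.inv_mul, ← e, 𝒢.mul_unit]

theorem inv_inv (𝒢 : LieGroupoid n d M G) (g : G) : 𝒢.inv (𝒢.inv g) = g := by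
  have h := 𝒢.mul_inv_cancel_left (𝒢.inv g) g
  have h1 : 𝒢.mul (𝒢.inv (𝒢.inv g)) (𝒢.mul (𝒢.inv g) g) = g :=
    𝒢.inv_mul_cancel_left _ _ (𝒢.src_inv g)
  rw [𝒢.inv_mul] at h1
  have h2 := 𝒢.mul_unit (𝒢.inv (𝒢.inv g))
  rw [𝒢.src_inv, 𝒢.tgt_inv] at h2
  rw [← h2, h1]

theorem inv_eq_of_mul (𝒢 : LieGroupoid n d M G) (g h : G) (e : 𝒢.src g = 𝒢.tgt h)
    (eh : 𝒢.mul g h = 𝒢.unit (𝒢.tgt g)) : 𝒢.inv g = h := by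
  have h1 := 𝒢.inv_mul_cancel_left g h e
  rw [eh] at h1
  have h2 := 𝒢.mul_unit (𝒢.inv g)
  rw [𝒢.src_inv] at h2
  rw [← h2, h1]

theorem mul_inv_rev (𝒢 : LieGroupoid n d M G) (g h : G) (e : 𝒢.src g = 𝒢.tgt h) :
    𝒢.inv (𝒢.mul g h) = 𝒢.mul (𝒢.inv h) (𝒢.inv g) := by
  have e1 : 𝒢.src (𝒢.inv h) = 𝒢.tgt (𝒢.inv g) := by rw [𝒢.src_inv, 𝒢.tgt_inv, e]
  apply 𝒢.inv_eq_of_mul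
  · rw [𝒢.src_mul _ _ e, 𝒢.tgt_mul _ _ e1, 𝒢.tgt_inv]
  · rw [𝒢.mul_assoc _ _ _ e (by rw [𝒢.tgt_mul _ _ e1, 𝒢.tgt_inv]),
      𝒢.mul_inv_cancel_left _ _ (by rw [𝒢.tgt_inv, e]), 𝒢.mul_inv, 𝒢.tgt_mul _ _ e]

end LieGroupoid

namespace RightTorsor

variable {n dK dP : ℕ} {M K P : Type*}
  [TopologicalSpace M] [ChartedSpace (EuclideanSpace ℝ (Fin n)) M]
  [TopologicalSpace K] [ChartedSpace (EuclideanSpace ℝ (Fin dK)) K]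
  [TopologicalSpace P] [ChartedSpace (EuclideanSpace ℝ (Fin dP)) P]
  {𝒦 : LieGroupBundle n dK M K} {pr : P → M}

theorem div_unique (R : RightTorsor dP 𝒦 P pr) {q p : P} {k : K} (hk : pr q = 𝒦.src k)
    (h : R.act q k = p) : R.div q p = k := by
  rw [← h, R.div_act _ _ hk]

theorem div_mul (R : RightTorsor dP 𝒦 P pr) (r q p : P) (h1 : pr r = pr q) (h2 : pr q = pr p) :
    𝒦.mul (R.div r q) (R.div q p) = R.div r p := by
  have e1 := R.src_div r q h1
  have e2 := R.src_div q p h2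
  have e : 𝒦.src (R.div r q) = 𝒦.tgt (R.div q p) := by rw [𝒦.tgt_eq_src, e1, e2, h1]
  symm
  apply R.div_unique
  · rw [𝒦.src_mul _ _ e, e2, h1]
  · rw [← R.act_mul _ _ _ e1.symm (by rw [e2, h1]), R.act_div _ _ h1, R.act_div _ _ h2]

theorem div_self (R : RightTorsor dP 𝒦 P pr) (p : P) : R.div p p = 𝒦.unit (pr p) :=
  R.div_unique (𝒦.src_unit _).symm (R.act_unit p)

theorem div_act_right (R : RightTorsor dP 𝒦 P pr) (q p : P) (k : K) (h1 : pr q = pr p)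
    (h2 : pr p = 𝒦.src k) : R.div q (R.act p k) = 𝒦.mul (R.div q p) k := by
  rw [← R.div_mul q p _ h1 (R.pr_act p k h2).symm, R.div_act _ _ h2]

theorem div_inv (R : RightTorsor dP 𝒦 P pr) (q p : P) (h : pr q = pr p) :
    𝒦.inv (R.div q p) = R.div p q := by
  have e1 := R.src_div q p h
  have e2 := R.src_div p q h.symm
  apply 𝒦.inv_eq_of_mul
  · rw [𝒦.tgt_eq_src, e1, e2, h]
  · rw [R.div_mul _ _ _ h h.symm, R.div_self, 𝒦.tgt_eq_src, e1]

theorem div_act_left (R : RightTorsor dP 𝒦 P pr) (q p : P) (k : K) (h1 : pr q = pr p)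
    (h2 : pr q = 𝒦.src k) : R.div (R.act q k) p = 𝒦.mul (𝒦.inv k) (R.div q p) := by
  have e := R.pr_act q k h2
  rw [← R.div_inv _ _ (h1.symm.trans e.symm), R.div_act_right _ _ _ h1.symm h2,
    𝒦.mul_inv_rev, R.div_inv _ _ h1.symm]
  rw [R.src_div _ _ h1.symm, 𝒦.tgt_eq_src, ← h2, h1]

/-- Around every point, some (set-theoretic) section of `P` is smooth. -/
theorem exists_localSection (R : RightTorsor dP 𝒦 P pr) (x : M) :
    ∃ (σ : M → P) (U : Set M), IsOpen U ∧ x ∈ U ∧ (∀ y, pr (σ y) = y) ∧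
      ContMDiffOn (𝓡 n) (𝓡 dP) ∞ σ U := by
  classical
  obtain ⟨p, rfl⟩ := R.surjective x
  have hs := R.isSubmersion.isSubmersionAt p
  set φ := hs.domChart
  set ψ := hs.codChart
  set c := (hs.equiv (φ p)).2
  have hp : p ∈ φ.source := hs.mem_domChart_source
  have hx : pr p ∈ ψ.source := hs.mem_codChart_source
  have hw := hs.writtenInCharts
  let σ₀ : M → P := fun y => φ.symm (hs.equiv.symm (ψ y, c))
  let A : EuclideanSpace ℝ (Fin n) → EuclideanSpace ℝ (Fin dP) := fun v => hs.equiv.symm (v, c)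
  have hA : ContMDiff (𝓡 n) (𝓡 dP) ∞ A := by
    rw [contMDiff_iff_contDiff]
    exact hs.equiv.symm.contDiff.comp (contDiff_id.prodMk contDiff_const)
  have hA0 : A (ψ (pr p)) = φ p := by
    have h1 := hw (x := φ p) (by simpa using φ.map_source hp)
    simp only [Function.comp_apply, OpenPartialHomeomorph.extend_coe,
      OpenPartialHomeomorph.extend_coe_symm, modelWithCornersSelf_coe,
      modelWithCornersSelf_coe_symm, id] at h1
    have h1' : ψ (pr (φ.symm (φ p))) = (hs.equiv (φ p)).1 := h1
    rw [φ.left_inv hp] at h1'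
    change hs.equiv.symm (ψ (pr p), (hs.equiv (φ p)).2) = φ p
    rw [h1', Prod.mk.eta, ContinuousLinearEquiv.symm_apply_apply]
  let U : Set M := ψ.source ∩ ψ ⁻¹' (A ⁻¹' φ.target)
  have hU : IsOpen U := ψ.isOpen_inter_preimage (φ.open_target.preimage hA.continuous)
  have hxU : pr p ∈ U := ⟨hx, by
    change A (ψ (pr p)) ∈ φ.target
    rw [hA0]; exact φ.map_source hp⟩
  have hsm : ContMDiffOn (𝓡 n) (𝓡 dP) ∞ σ₀ U := by
    have h1 : ContMDiffOn (𝓡 n) (𝓡 n) ∞ ψ ψ.source :=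
      contMDiffOn_of_mem_maximalAtlas hs.codChart_mem_maximalAtlas
    have h2 : ContMDiffOn (𝓡 dP) (𝓡 dP) ∞ φ.symm φ.target :=
      contMDiffOn_symm_of_mem_maximalAtlas hs.domChart_mem_maximalAtlas
    exact h2.comp (hA.comp_contMDiffOn (h1.mono inter_subset_left)) (fun y hy => hy.2)
  have hpr : ∀ y ∈ U, pr (σ₀ y) = y := by
    intro y hy
    have h1 := hw (x := A (ψ y)) (by simpa using hy.2)
    have h1' : ψ (pr (φ.symm (A (ψ y)))) = (hs.equiv (A (ψ y))).1 := h1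
    have h2 : hs.equiv (A (ψ y)) = (ψ y, c) := hs.equiv.apply_symm_apply _
    rw [h2] at h1'
    exact ψ.injOn (hs.source_subset_preimage_source (φ.map_target hy.2)) hy.1 h1'
  refine ⟨fun y => if y ∈ U then σ₀ y else (R.surjective y).choose, U, hU, hxU, ?_, ?_⟩
  · intro y
    by_cases hy : y ∈ U
    · simp only [hy, if_true]; exact hpr y hy
    · simp only [hy, if_false]; exact (R.surjective y).choose_spec
  · exact hsm.congr (fun y hy => by simp only [hy, if_true])

/-- A section of `P` which is smooth near `x`. -/
noncomputable def sec (R : RightTorsor dP 𝒦 P pr) (x : M) : M → P :=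
  (R.exists_localSection x).choose

/-- An open neighbourhood of `x` on which `R.sec x` is smooth. -/
def dom (R : RightTorsor dP 𝒦 P pr) (x : M) : Set M :=
  (R.exists_localSection x).choose_spec.choose

theorem isOpen_dom (R : RightTorsor dP 𝒦 P pr) (x : M) : IsOpen (R.dom x) :=
  (R.exists_localSection x).choose_spec.choose_spec.1

theorem mem_dom (R : RightTorsor dP 𝒦 P pr) (x : M) : x ∈ R.dom x :=
  (R.exists_localSection x).choose_spec.choose_spec.2.1

theorem pr_sec (R : RightTorsor dP 𝒦 P pr) (x y : M) : pr (R.sec x y) = y :=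
  (R.exists_localSection x).choose_spec.choose_spec.2.2.1 y

theorem contMDiffOn_sec (R : RightTorsor dP 𝒦 P pr) (x : M) :
    ContMDiffOn (𝓡 n) (𝓡 dP) ∞ (R.sec x) (R.dom x) :=
  (R.exists_localSection x).choose_spec.choose_spec.2.2.2

end RightTorsor

section Twist

variable {n dK dG dE dP : ℕ} {M K G E P : Type*}
  [TopologicalSpace M] [ChartedSpace (EuclideanSpace ℝ (Fin n)) M]
  [TopologicalSpace K] [ChartedSpace (EuclideanSpace ℝ (Fin dK)) K]
  [TopologicalSpace G] [ChartedSpace (EuclideanSpace ℝ (Fin dG)) G]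
  [TopologicalSpace E] [ChartedSpace (EuclideanSpace ℝ (Fin dE)) E]
  [TopologicalSpace P] [ChartedSpace (EuclideanSpace ℝ (Fin dP)) P]
  {𝒦 : LieGroupBundle n dK M K} {𝒢 : LieGroupoid n dG M G} {ℰ : LieGroupoid n dE M E}
  {pr : P → M}

/-- The triples `(q, g, p⁻¹)` with `g : x → y` in `G`, `q ∈ P_y` and `p ∈ P_x`, as a subspace
of `P × G × P`. -/
abbrev Triple (𝒢 : LieGroupoid n dG M G) (pr : P → M) : Type _ :=
  {a : P × G × P // pr a.1 = 𝒢.tgt a.2.1 ∧ pr a.2.2 = 𝒢.src a.2.1}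

/-- The identifications `(q k, g, p⁻¹) ∼ (q, k g, p⁻¹)` and `(q, g l, p⁻¹) ∼ (q, g, l p⁻¹)`,
where `l p⁻¹ = (p l⁻¹)⁻¹`. -/
inductive TwistRel (X : Extension 𝒦 𝒢 ℰ) (R : RightTorsor dP 𝒦 P pr) :
    Triple 𝒢 pr → Triple 𝒢 pr → Prop
  | left (a b : Triple 𝒢 pr) (k : K) (hk : 𝒦.src k = 𝒢.tgt a.1.2.1)
      (hq : a.1.1 = R.act b.1.1 k) (hg : b.1.2.1 = 𝒢.mul (X.incl k) a.1.2.1)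
      (hp : a.1.2.2 = b.1.2.2) : TwistRel X R a b
  | right (a b : Triple 𝒢 pr) (l : K) (hl : 𝒦.src l = 𝒢.src b.1.2.1)
      (hq : a.1.1 = b.1.1) (hg : a.1.2.1 = 𝒢.mul b.1.2.1 (X.incl l))
      (hp : b.1.2.2 = R.act a.1.2.2 (𝒦.inv l)) : TwistRel X R a b

/-- The space of arrows of `P ⊗_K G ⊗_K P⁻¹`: the quotient of the space of triples by the
equivalence relation generated by `TwistRel`. -/
def Twist (X : Extension 𝒦 𝒢 ℰ) (R : RightTorsor dP 𝒦 P pr) : Type _ := Quot (TwistRel X R)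

/-- The quotient topology. -/
instance (X : Extension 𝒦 𝒢 ℰ) (R : RightTorsor dP 𝒦 P pr) : TopologicalSpace (Twist X R) :=
  inferInstanceAs (TopologicalSpace (Quot (TwistRel X R)))

namespace Twist

variable (X : Extension 𝒦 𝒢 ℰ) (R : RightTorsor dP 𝒦 P pr)

/-- The arrow `q ⊗ g ⊗ p⁻¹`. -/
def mk (q : P) (g : G) (p : P) (hq : pr q = 𝒢.tgt g) (hp : pr p = 𝒢.src g) : Twist X R :=
  Quot.mk _ ⟨(q, g, p), hq, hp⟩

theorem src_incl (k : K) : 𝒢.src (X.incl k) = 𝒦.src k := X.isHom_incl.map_src k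

theorem tgt_incl (k : K) : 𝒢.tgt (X.incl k) = 𝒦.src k :=
  (X.isHom_incl.map_tgt k).trans (𝒦.tgt_eq_src k)

variable {X R}

theorem rel_src {a b : Triple 𝒢 pr} (h : TwistRel X R a b) :
    𝒢.src a.1.2.1 = 𝒢.src b.1.2.1 := by
  cases h with
  | left k hk hq hg hp => rw [hg, 𝒢.src_mul _ _ ((src_incl X k).trans hk)]
  | right l hl hq hg hp =>
    rw [hg, 𝒢.src_mul _ _ (hl.symm.trans (tgt_incl X l).symm), src_incl, hl]

theorem rel_tgt {a b : Triple 𝒢 pr} (h : TwistRel X R a b) :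
    𝒢.tgt a.1.2.1 = 𝒢.tgt b.1.2.1 := by
  cases h with
  | left k hk hq hg hp => rw [hg, 𝒢.tgt_mul _ _ ((src_incl X k).trans hk), tgt_incl, hk]
  | right l hl hq hg hp => rw [hg, 𝒢.tgt_mul _ _ (hl.symm.trans (tgt_incl X l).symm)]

theorem mk_congr {q q' p p' : P} {g g' : G} (h1 : q = q') (h2 : g = g') (h3 : p = p')
    (hq : pr q = 𝒢.tgt g) (hp : pr p = 𝒢.src g) (hq' : pr q' = 𝒢.tgt g')
    (hp' : pr p' = 𝒢.src g') : mk X R q g p hq hp = mk X R q' g' p' hq' hp' := by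
  subst h1 h2 h3; rfl

variable (X R)

/-- The source of `q ⊗ g ⊗ p⁻¹` is the source of `g`. -/
def src : Twist X R → M := Quot.lift (fun a => 𝒢.src a.1.2.1) (fun _ _ h => rel_src h)

/-- The target of `q ⊗ g ⊗ p⁻¹` is the target of `g`. -/
def tgt : Twist X R → M := Quot.lift (fun a => 𝒢.tgt a.1.2.1) (fun _ _ h => rel_tgt h)

/-- `π_P (q ⊗ g ⊗ p⁻¹) = π g`. -/
def proj : Twist X R → E := Quot.lift (fun a => X.proj a.1.2.1) (by
  have key : ∀ k, X.proj (X.incl k) = ℰ.unit (𝒦.src k) := by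
    intro k
    obtain ⟨x, hx⟩ := (X.exact (X.incl k)).2 ⟨k, rfl⟩
    have := X.isHom_proj.map_src (X.incl k)
    rw [hx, ℰ.src_unit, src_incl] at this
    rw [hx, this]
  intro a b h
  cases h with
  | left k hk hq hg hp =>
    rw [hg, X.isHom_proj.map_mul _ _ ((src_incl X k).trans hk), key, hk,
      ← X.isHom_proj.map_tgt, ℰ.unit_mul]
  | right l hl hq hg hp =>
    rw [hg, X.isHom_proj.map_mul _ _ (hl.symm.trans (tgt_incl X l).symm), key, hl,
      ← X.isHom_proj.map_src, ℰ.mul_unit])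

/-- The product `h (s⁻¹ q) g` in `G`, where `s⁻¹ q ∈ K` is the division of `q` by `s`. -/
def midMul (h : G) (s q : P) (g : G) : G := 𝒢.mul (𝒢.mul h (X.incl (R.div s q))) g

variable {X R} in
theorem midMul_aux1 {h g : G} {s q : P} (h1 : pr s = 𝒢.src h) (h2 : pr q = 𝒢.tgt g)
    (h3 : 𝒢.src h = 𝒢.tgt g) : 𝒢.src h = 𝒢.tgt (X.incl (R.div s q)) := by
  rw [tgt_incl, R.src_div _ _ (by rw [h1, h2, h3]), h1]

variable {X R} in
theorem midMul_aux2 {h g : G} {s q : P} (h1 : pr s = 𝒢.src h) (h2 : pr q = 𝒢.tgt g)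
    (h3 : 𝒢.src h = 𝒢.tgt g) : 𝒢.src (𝒢.mul h (X.incl (R.div s q))) = 𝒢.tgt g := by
  rw [𝒢.src_mul _ _ (midMul_aux1 h1 h2 h3), src_incl, R.src_div _ _ (by rw [h1, h2, h3]), h1, h3]

variable {X R} in
theorem src_midMul {h g : G} {s q : P} (h1 : pr s = 𝒢.src h) (h2 : pr q = 𝒢.tgt g)
    (h3 : 𝒢.src h = 𝒢.tgt g) : 𝒢.src (midMul X R h s q g) = 𝒢.src g :=
  𝒢.src_mul _ _ (midMul_aux2 h1 h2 h3)

variable {X R} in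
theorem tgt_midMul {h g : G} {s q : P} (h1 : pr s = 𝒢.src h) (h2 : pr q = 𝒢.tgt g)
    (h3 : 𝒢.src h = 𝒢.tgt g) : 𝒢.tgt (midMul X R h s q g) = 𝒢.tgt h := by
  rw [midMul, 𝒢.tgt_mul _ _ (midMul_aux2 h1 h2 h3), 𝒢.tgt_mul _ _ (midMul_aux1 h1 h2 h3)]

open Classical in
/-- Composition of representatives, `(r ⊗ h ⊗ s⁻¹) (q ⊗ g ⊗ p⁻¹) = r ⊗ h (s⁻¹ q) g ⊗ p⁻¹`;
the value on non-composable arrows is irrelevant. -/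
noncomputable def mulAux (a b : Triple 𝒢 pr) : Twist X R :=
  if e : 𝒢.src a.1.2.1 = 𝒢.tgt b.1.2.1 then
    mk X R a.1.1 (midMul X R a.1.2.1 a.1.2.2 b.1.1 b.1.2.1) b.1.2.2
      (by rw [a.2.1, tgt_midMul a.2.2 b.2.1 e]) (by rw [b.2.2, src_midMul a.2.2 b.2.1 e])
  else Quot.mk _ a

variable {X R} in
theorem mulAux_pos {a b : Triple 𝒢 pr} (e : 𝒢.src a.1.2.1 = 𝒢.tgt b.1.2.1) :
    mulAux X R a b = mk X R a.1.1 (midMul X R a.1.2.1 a.1.2.2 b.1.1 b.1.2.1) b.1.2.2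
      (by rw [a.2.1, tgt_midMul a.2.2 b.2.1 e]) (by rw [b.2.2, src_midMul a.2.2 b.2.1 e]) :=
  dif_pos e

variable {X R} in
theorem mulAux_neg {a b : Triple 𝒢 pr} (e : ¬ 𝒢.src a.1.2.1 = 𝒢.tgt b.1.2.1) :
    mulAux X R a b = Quot.mk _ a :=
  dif_neg e

theorem mulAux_left {a a' : Triple 𝒢 pr} (b : Triple 𝒢 pr) (h : TwistRel X R a a') :
    mulAux X R a b = mulAux X R a' b := by
  have hs := rel_src h
  have h0 := h
  by_cases e : 𝒢.src a.1.2.1 = 𝒢.tgt b.1.2.1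
  · have e' := hs.symm.trans e
    rw [mulAux_pos e, mulAux_pos e']
    cases h with
    | left k hk hq hg hp =>
      refine Quot.sound (TwistRel.left _ _ k ?_ hq ?_ rfl)
      · exact hk.trans (tgt_midMul a.2.2 b.2.1 e).symm
      · have c1 : 𝒢.src (X.incl k) = 𝒢.tgt a.1.2.1 := (src_incl X k).trans hk
        have c2 := midMul_aux1 (X := X) (R := R) a.2.2 b.2.1 e
        have c3 := midMul_aux2 (X := X) (R := R) a.2.2 b.2.1 e
        change midMul X R a'.1.2.1 a'.1.2.2 _ _ = 𝒢.mul _ (midMul X R _ _ _ _)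
        rw [midMul, midMul, hg, ← hp, 𝒢.mul_assoc _ _ _ c1 c2,
          𝒢.mul_assoc _ _ _ (by rw [c1, 𝒢.tgt_mul _ _ c2]) c3]
    | right l hl hq hg hp =>
      refine mk_congr hq ?_ rfl _ _ _ _
      have c0 : pr a.1.2.2 = pr b.1.1 := by rw [a.2.2, e, b.2.1]
      have c1 : pr a.1.2.2 = 𝒦.src (𝒦.inv l) := by
        rw [a.2.2, hs, 𝒦.src_inv, 𝒦.tgt_eq_src, hl]
      have c2 : 𝒢.src a'.1.2.1 = 𝒢.tgt (X.incl l) := by rw [tgt_incl, hl]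
      have c3 : 𝒦.src l = 𝒦.tgt (R.div a.1.2.2 b.1.1) := by
        rw [𝒦.tgt_eq_src, R.src_div _ _ c0, a.2.2, hs, hl]
      have c4 : 𝒢.src (X.incl l) = 𝒢.tgt (X.incl (R.div a.1.2.2 b.1.1)) := by
        rw [src_incl, tgt_incl, c3, 𝒦.tgt_eq_src]
      rw [midMul, midMul, hp, R.div_act_left _ _ _ c0 c1, 𝒦.inv_inv, hg,
        X.isHom_incl.map_mul _ _ c3, 𝒢.mul_assoc _ _ _ c2 c4]
  · have e' : ¬ 𝒢.src a'.1.2.1 = 𝒢.tgt b.1.2.1 := fun e' => e (hs.trans e')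
    rw [mulAux_neg e, mulAux_neg e']
    exact Quot.sound h0

theorem mulAux_right (a : Triple 𝒢 pr) {b b' : Triple 𝒢 pr} (h : TwistRel X R b b') :
    mulAux X R a b = mulAux X R a b' := by
  have ht := rel_tgt h
  by_cases e : 𝒢.src a.1.2.1 = 𝒢.tgt b.1.2.1
  · have e' := e.trans ht
    rw [mulAux_pos e, mulAux_pos e']
    cases h with
    | left k hk hq hg hp =>
      refine mk_congr rfl ?_ hp _ _ _ _
      have c0 : pr a.1.2.2 = pr b'.1.1 := by rw [a.2.2, e', b'.2.1]
      have c1 : pr b'.1.1 = 𝒦.src k := by rw [b'.2.1, ← ht, hk]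
      have c2 : 𝒦.src (R.div a.1.2.2 b'.1.1) = 𝒦.tgt k := by
        rw [𝒦.tgt_eq_src, R.src_div _ _ c0, c0, c1]
      have c3 : 𝒢.src a.1.2.1 = 𝒢.tgt (X.incl (R.div a.1.2.2 b'.1.1)) :=
        midMul_aux1 a.2.2 b'.2.1 e'
      have c4 : 𝒢.src (X.incl (R.div a.1.2.2 b'.1.1)) = 𝒢.tgt (X.incl k) := by
        rw [src_incl, tgt_incl, c2, 𝒦.tgt_eq_src]
      have c5 : 𝒢.src (X.incl k) = 𝒢.tgt b.1.2.1 := by rw [src_incl, hk]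
      rw [midMul, midMul, hq, R.div_act_right _ _ _ c0 c1, X.isHom_incl.map_mul _ _ c2, hg,
        ← 𝒢.mul_assoc _ _ _ c3 c4, 𝒢.mul_assoc _ _ _ (by rw [𝒢.src_mul _ _ c3, c4]) c5]
    | right l hl hq hg hp =>
      refine Quot.sound (TwistRel.right _ _ l ?_ rfl ?_ hp)
      · exact hl.trans (src_midMul a.2.2 b'.2.1 e').symm
      · have c1 : 𝒢.src b'.1.2.1 = 𝒢.tgt (X.incl l) := by rw [tgt_incl, hl]
        have c3 := midMul_aux2 (X := X) (R := R) a.2.2 b'.2.1 e'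
        change midMul X R _ _ _ _ = 𝒢.mul (midMul X R _ _ _ _) _
        rw [midMul, midMul, hq, hg, 𝒢.mul_assoc _ _ _ c3 c1]
  · have e' : ¬ 𝒢.src a.1.2.1 = 𝒢.tgt b'.1.2.1 := fun e' => e (e'.trans ht.symm)
    rw [mulAux_neg e, mulAux_neg e']

/-- Composition in `P ⊗_K G ⊗_K P⁻¹`. -/
noncomputable def mul : Twist X R → Twist X R → Twist X R :=
  Quot.lift (fun a => Quot.lift (mulAux X R a) (fun _ _ h => mulAux_right X R a h))
    (fun a a' h => by
      funext w
      induction w using Quot.ind with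
      | mk b => exact mulAux_left X R b h)

/-- `(q ⊗ g ⊗ p⁻¹)⁻¹ = p ⊗ g⁻¹ ⊗ q⁻¹`. -/
def inv : Twist X R → Twist X R :=
  Quot.lift (fun a => mk X R a.1.2.2 (𝒢.inv a.1.2.1) a.1.1
      (by rw [a.2.2, 𝒢.tgt_inv]) (by rw [a.2.1, 𝒢.src_inv])) (by
    intro a b h
    have hs := rel_src h
    have ht := rel_tgt h
    have incl_inv : ∀ l, X.incl (𝒦.inv l) = 𝒢.inv (X.incl l) := X.isHom_incl.map_inv
    cases h with
    | left k hk hq hg hp =>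
      have c1 : 𝒢.src (X.incl k) = 𝒢.tgt a.1.2.1 := (src_incl X k).trans hk
      refine (Quot.sound (TwistRel.right _ _ (𝒦.inv k) ?_ hp.symm ?_ ?_)).symm
      · change 𝒦.src (𝒦.inv k) = 𝒢.src (𝒢.inv a.1.2.1)
        rw [𝒦.src_inv, 𝒦.tgt_eq_src, 𝒢.src_inv, hk]
      · change 𝒢.inv b.1.2.1 = 𝒢.mul (𝒢.inv a.1.2.1) (X.incl (𝒦.inv k))
        rw [hg, 𝒢.mul_inv_rev _ _ c1, incl_inv]
      · change a.1.1 = R.act b.1.1 (𝒦.inv (𝒦.inv k))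
        rw [𝒦.inv_inv, hq]
    | right l hl hq hg hp =>
      have c1 : 𝒢.src b.1.2.1 = 𝒢.tgt (X.incl l) := hl.symm.trans (tgt_incl X l).symm
      refine (Quot.sound (TwistRel.left _ _ (𝒦.inv l) ?_ hp ?_ hq.symm)).symm
      · change 𝒦.src (𝒦.inv l) = 𝒢.tgt (𝒢.inv b.1.2.1)
        rw [𝒦.src_inv, 𝒦.tgt_eq_src, 𝒢.tgt_inv, hl]
      · change 𝒢.inv a.1.2.1 = 𝒢.mul (X.incl (𝒦.inv l)) (𝒢.inv b.1.2.1)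
        rw [hg, 𝒢.mul_inv_rev _ _ c1, incl_inv])

/-- The unit arrow `p ⊗ 1_x ⊗ p⁻¹`, for any `p ∈ P_x`. -/
noncomputable def unit (x : M) : Twist X R :=
  mk X R (R.sec x x) (𝒢.unit x) (R.sec x x) (by rw [R.pr_sec, 𝒢.tgt_unit])
    (by rw [R.pr_sec, 𝒢.src_unit])

/-- The structure maps of the groupoid `P ⊗_K G ⊗_K P⁻¹`. -/
noncomputable def groupoidData : GroupoidData M (Twist X R) where
  src := src X R
  tgt := tgt X R
  mul := mul X R
  inv := inv X R
  unit := unit X R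

/-! #### The smooth structure

For local sections `σ, τ` of `P`, the arrows of `P ⊗_K G ⊗_K P⁻¹` from `dom τ` to `dom σ` are
identified with those of `G` by `g ↦ σ(t g) ⊗ g ⊗ τ(s g)⁻¹`; composing with the charts of `G`
gives the charts. -/

/-- The arrow `(σ(t g)⁻¹ q) g (p⁻¹ τ(s g))` of `G`. -/
def toAux (σ τ : M → P) (a : P × G × P) : G :=
  𝒢.mul (𝒢.mul (X.incl (R.div (σ (𝒢.tgt a.2.1)) a.1)) a.2.1)
    (X.incl (R.div a.2.2 (τ (𝒢.src a.2.1))))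

section
variable {X R} {σ τ : M → P}

theorem toAux_c1 {a : P × G × P} (ha : pr a.1 = 𝒢.tgt a.2.1) (hσ : ∀ y, pr (σ y) = y) :
    𝒢.src (X.incl (R.div (σ (𝒢.tgt a.2.1)) a.1)) = 𝒢.tgt a.2.1 := by
  rw [src_incl, R.src_div _ _ (by rw [hσ, ha]), hσ]

theorem toAux_c2 {a : P × G × P} (ha' : pr a.2.2 = 𝒢.src a.2.1) (hτ : ∀ y, pr (τ y) = y) :
    𝒢.src a.2.1 = 𝒢.tgt (X.incl (R.div a.2.2 (τ (𝒢.src a.2.1)))) := by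
  rw [tgt_incl, R.src_div _ _ (by rw [hτ, ha']), ha']

theorem toAux_c3 {a : P × G × P} (ha : pr a.1 = 𝒢.tgt a.2.1) (ha' : pr a.2.2 = 𝒢.src a.2.1)
    (hσ : ∀ y, pr (σ y) = y) (hτ : ∀ y, pr (τ y) = y) :
    𝒢.src (𝒢.mul (X.incl (R.div (σ (𝒢.tgt a.2.1)) a.1)) a.2.1)
      = 𝒢.tgt (X.incl (R.div a.2.2 (τ (𝒢.src a.2.1)))) := by
  exact (𝒢.src_mul _ _ (toAux_c1 ha hσ)).trans (toAux_c2 ha' hτ)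

theorem src_toAux {a : P × G × P} (ha : pr a.1 = 𝒢.tgt a.2.1) (ha' : pr a.2.2 = 𝒢.src a.2.1)
    (hσ : ∀ y, pr (σ y) = y) (hτ : ∀ y, pr (τ y) = y) :
    𝒢.src (toAux X R σ τ a) = 𝒢.src a.2.1 := by
  rw [toAux, 𝒢.src_mul _ _ (toAux_c3 ha ha' hσ hτ), src_incl, R.src_div _ _ (by rw [hτ, ha']), ha']

theorem tgt_toAux {a : P × G × P} (ha : pr a.1 = 𝒢.tgt a.2.1) (ha' : pr a.2.2 = 𝒢.src a.2.1)
    (hσ : ∀ y, pr (σ y) = y) (hτ : ∀ y, pr (τ y) = y) :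
    𝒢.tgt (toAux X R σ τ a) = 𝒢.tgt a.2.1 := by
  rw [toAux, 𝒢.tgt_mul _ _ (toAux_c3 ha ha' hσ hτ), 𝒢.tgt_mul _ _ (toAux_c1 ha hσ), tgt_incl,
    R.src_div _ _ (by rw [hσ, ha]), hσ]

theorem toAux_rel (hσ : ∀ y, pr (σ y) = y) (hτ : ∀ y, pr (τ y) = y) {a b : Triple 𝒢 pr}
    (h : TwistRel X R a b) : toAux X R σ τ a.1 = toAux X R σ τ b.1 := by
  have hs := rel_src h
  have ht := rel_tgt h
  cases h with
  | left k hk hq hg hp =>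
    have c1 : 𝒢.src (X.incl k) = 𝒢.tgt a.1.2.1 := (src_incl X k).trans hk
    have c2 : pr (σ (𝒢.tgt b.1.2.1)) = pr b.1.1 := by rw [hσ, b.2.1]
    have c3 : pr b.1.1 = 𝒦.src k := by rw [b.2.1, ← ht, hk]
    have c4 : 𝒦.src (R.div (σ (𝒢.tgt b.1.2.1)) b.1.1) = 𝒦.tgt k := by
      rw [R.src_div _ _ c2, 𝒦.tgt_eq_src, c2, c3]
    have c5 : 𝒢.src (X.incl (R.div (σ (𝒢.tgt b.1.2.1)) b.1.1)) = 𝒢.tgt (X.incl k) := by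
      rw [src_incl, tgt_incl, c4, 𝒦.tgt_eq_src]
    rw [toAux, toAux, hp, hs, ht, hq, R.div_act_right _ _ _ c2 c3, X.isHom_incl.map_mul _ _ c4,
      𝒢.mul_assoc _ _ _ c5 c1, ← hg]
  | right l hl hq hg hp =>
    have c1 : 𝒢.src b.1.2.1 = 𝒢.tgt (X.incl l) := hl.symm.trans (tgt_incl X l).symm
    have c2 : pr a.1.2.2 = pr (τ (𝒢.src b.1.2.1)) := by rw [hτ, a.2.2, hs]
    have c3 : pr a.1.2.2 = 𝒦.src (𝒦.inv l) := by
      rw [a.2.2, hs, 𝒦.src_inv, 𝒦.tgt_eq_src, hl]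
    have c4 : 𝒦.src l = 𝒦.tgt (R.div a.1.2.2 (τ (𝒢.src b.1.2.1))) := by
      rw [𝒦.tgt_eq_src, R.src_div _ _ c2, a.2.2, hs, hl]
    have c5 : 𝒢.src (X.incl l) = 𝒢.tgt (X.incl (R.div a.1.2.2 (τ (𝒢.src b.1.2.1)))) := by
      rw [src_incl, tgt_incl, c4, 𝒦.tgt_eq_src]
    have c6 : 𝒢.src (X.incl (R.div (σ (𝒢.tgt b.1.2.1)) b.1.1)) = 𝒢.tgt b.1.2.1 :=
      toAux_c1 b.2.1 hσ
    rw [toAux, toAux, hq, hp, hs, ht, R.div_act_left _ _ _ c2 c3, 𝒦.inv_inv,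
      X.isHom_incl.map_mul _ _ c4, hg, ← 𝒢.mul_assoc _ _ _ c6 c1,
      𝒢.mul_assoc _ _ _ (by rw [𝒢.src_mul _ _ c6, c1]) c5]

theorem contMDiffOn_toAux (hσ : ∀ y, pr (σ y) = y) (hτ : ∀ y, pr (τ y) = y) {V U : Set M}
    (sσ : ContMDiffOn (𝓡 n) (𝓡 dP) ∞ σ V) (sτ : ContMDiffOn (𝓡 n) (𝓡 dP) ∞ τ U) :
    ContMDiffOn ((𝓡 dP).prod ((𝓡 dG).prod (𝓡 dP))) (𝓡 dG) ∞ (toAux X R σ τ)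
      {a | pr a.1 = 𝒢.tgt a.2.1 ∧ pr a.2.2 = 𝒢.src a.2.1 ∧ 𝒢.tgt a.2.1 ∈ V ∧
        𝒢.src a.2.1 ∈ U} := by
  set S : Set (P × G × P) := {a | pr a.1 = 𝒢.tgt a.2.1 ∧ pr a.2.2 = 𝒢.src a.2.1 ∧
    𝒢.tgt a.2.1 ∈ V ∧ 𝒢.src a.2.1 ∈ U}
  have hg : ContMDiffOn ((𝓡 dP).prod ((𝓡 dG).prod (𝓡 dP))) (𝓡 dG) ∞
      (fun a : P × G × P => a.2.1) S := (contMDiff_fst.comp contMDiff_snd).contMDiffOn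
  have hp : ContMDiffOn ((𝓡 dP).prod ((𝓡 dG).prod (𝓡 dP))) (𝓡 dP) ∞
      (fun a : P × G × P => a.2.2) S := (contMDiff_snd.comp contMDiff_snd).contMDiffOn
  have hq : ContMDiffOn ((𝓡 dP).prod ((𝓡 dG).prod (𝓡 dP))) (𝓡 dP) ∞
      (fun a : P × G × P => a.1) S := contMDiff_fst.contMDiffOn
  have h1 : ContMDiffOn ((𝓡 dP).prod ((𝓡 dG).prod (𝓡 dP))) (𝓡 dP) ∞
      (fun a : P × G × P => σ (𝒢.tgt a.2.1)) S :=
    sσ.comp (𝒢.isSubmersion_tgt.contMDiff.comp_contMDiffOn hg) (fun a ha => ha.2.2.1)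
  have h2 : ContMDiffOn ((𝓡 dP).prod ((𝓡 dG).prod (𝓡 dP))) (𝓡 dP) ∞
      (fun a : P × G × P => τ (𝒢.src a.2.1)) S :=
    sτ.comp (𝒢.isSubmersion_src.contMDiff.comp_contMDiffOn hg) (fun a ha => ha.2.2.2)
  have h3 : ContMDiffOn ((𝓡 dP).prod ((𝓡 dG).prod (𝓡 dP))) (𝓡 dG) ∞
      (fun a : P × G × P => X.incl (R.div (σ (𝒢.tgt a.2.1)) a.1)) S :=
    X.isSmoothEmbedding_incl.contMDiff.comp_contMDiffOn
      (R.contMDiffOn_div.comp (h1.prodMk hq) (fun a ha => by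
        change pr (σ _) = pr a.1
        rw [hσ, ha.1]))
  have h4 : ContMDiffOn ((𝓡 dP).prod ((𝓡 dG).prod (𝓡 dP))) (𝓡 dG) ∞
      (fun a : P × G × P => X.incl (R.div a.2.2 (τ (𝒢.src a.2.1)))) S :=
    X.isSmoothEmbedding_incl.contMDiff.comp_contMDiffOn
      (R.contMDiffOn_div.comp (hp.prodMk h2) (fun a ha => by
        change pr a.2.2 = pr (τ _)
        rw [hτ, ha.2.1]))
  exact 𝒢.contMDiffOn_mul.comp ((𝒢.contMDiffOn_mul.comp (h3.prodMk hg)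
    (fun a ha => toAux_c1 ha.1 hσ)).prodMk h4) (fun a ha => toAux_c3 ha.1 ha.2.1 hσ hτ)

end

variable (x y : M)

/-- The map `q ⊗ g ⊗ p⁻¹ ↦ (σ(t g)⁻¹ q) g (p⁻¹ τ(s g))`, for the chosen sections `σ` near `y`
and `τ` near `x`. -/
noncomputable def toArrow : Twist X R → G :=
  Quot.lift (fun a => toAux X R (R.sec y) (R.sec x) a.1)
    (fun _ _ h => toAux_rel (R.pr_sec y) (R.pr_sec x) h)

/-- The map `g ↦ σ(t g) ⊗ g ⊗ τ(s g)⁻¹`, for the chosen sections `σ` near `y` and `τ` near `x`. -/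
noncomputable def ofArrow (g : G) : Twist X R :=
  mk X R (R.sec y (𝒢.tgt g)) g (R.sec x (𝒢.src g)) (R.pr_sec _ _) (R.pr_sec _ _)

theorem toArrow_ofArrow (g : G) : toArrow X R x y (ofArrow X R x y g) = g := by
  change 𝒢.mul (𝒢.mul (X.incl (R.div (R.sec y (𝒢.tgt g)) (R.sec y (𝒢.tgt g)))) g)
    (X.incl (R.div (R.sec x (𝒢.src g)) (R.sec x (𝒢.src g)))) = g
  rw [R.div_self, R.div_self, R.pr_sec, R.pr_sec, X.isHom_incl.map_unit, X.isHom_incl.map_unit,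
    𝒢.unit_mul, 𝒢.mul_unit]

theorem ofArrow_toArrow (w : Twist X R) : ofArrow X R x y (toArrow X R x y w) = w := by
  induction w using Quot.ind with
  | mk a =>
    have hσ := R.pr_sec y
    have hτ := R.pr_sec x
    have e1 := src_toAux (X := X) (R := R) a.2.1 a.2.2 hσ hτ
    have e2 := tgt_toAux (X := X) (R := R) a.2.1 a.2.2 hσ hτ
    have c1 := toAux_c1 (X := X) (R := R) a.2.1 hσ
    have c2 := toAux_c2 (X := X) (R := R) a.2.2 hτ
    have d1 : pr (R.sec y (𝒢.tgt a.1.2.1)) = pr a.1.1 := by rw [hσ, a.2.1]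
    have d2 : pr a.1.2.2 = pr (R.sec x (𝒢.src a.1.2.1)) := by rw [hτ, a.2.2]
    set k := R.div (R.sec y (𝒢.tgt a.1.2.1)) a.1.1 with hk
    set l := R.div a.1.2.2 (R.sec x (𝒢.src a.1.2.1)) with hl
    have ek : 𝒦.src k = 𝒢.tgt a.1.2.1 := by rw [hk, R.src_div _ _ d1, hσ]
    have el : 𝒦.src l = 𝒢.src a.1.2.1 := by rw [hl, R.src_div _ _ d2, a.2.2]
    have s1 : 𝒢.src (𝒢.mul a.1.2.1 (X.incl l)) = 𝒢.src a.1.2.1 := by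
      rw [𝒢.src_mul _ _ c2, src_incl, el]
    have s2 : 𝒢.tgt (𝒢.mul a.1.2.1 (X.incl l)) = 𝒢.tgt a.1.2.1 := 𝒢.tgt_mul _ _ c2
    have step1 : mk X R a.1.1 (𝒢.mul a.1.2.1 (X.incl l)) (R.sec x (𝒢.src a.1.2.1))
        (by rw [a.2.1, s2]) (by rw [s1, hτ]) = Quot.mk _ a := by
      refine Quot.sound (TwistRel.right _ _ l el rfl rfl ?_)
      change a.1.2.2 = R.act (R.sec x (𝒢.src a.1.2.1)) (𝒦.inv l)
      rw [hl, R.div_inv _ _ d2, R.act_div _ _ d2.symm]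
    have step2 : mk X R a.1.1 (𝒢.mul a.1.2.1 (X.incl l)) (R.sec x (𝒢.src a.1.2.1))
        (by rw [a.2.1, s2]) (by rw [s1, hτ]) =
        ofArrow X R x y (toAux X R (R.sec y) (R.sec x) a.1) := by
      refine Quot.sound (TwistRel.left _ _ k (ek.trans s2.symm) ?_ ?_ ?_)
      · change a.1.1 = R.act (R.sec y (𝒢.tgt (toAux X R (R.sec y) (R.sec x) a.1))) k
        rw [e2, hk, R.act_div _ _ d1]
      · exact 𝒢.mul_assoc _ _ _ c1 c2
      · change R.sec x _ = R.sec x (𝒢.src (toAux X R (R.sec y) (R.sec x) a.1))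
        rw [e1]
    exact step2.symm.trans step1

theorem continuous_src : Continuous (src X R) :=
  continuous_quot_lift _ (𝒢.isSubmersion_src.contMDiff.continuous.comp
    (continuous_fst.comp (continuous_snd.comp continuous_subtype_val)))

theorem continuous_tgt : Continuous (tgt X R) :=
  continuous_quot_lift _ (𝒢.isSubmersion_tgt.contMDiff.continuous.comp
    (continuous_fst.comp (continuous_snd.comp continuous_subtype_val)))

theorem src_toArrow (w : Twist X R) : 𝒢.src (toArrow X R x y w) = src X R w := by
  induction w using Quot.ind with
  | mk a => exact src_toAux a.2.1 a.2.2 (R.pr_sec y) (R.pr_sec x)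

theorem tgt_toArrow (w : Twist X R) : 𝒢.tgt (toArrow X R x y w) = tgt X R w := by
  induction w using Quot.ind with
  | mk a => exact tgt_toAux a.2.1 a.2.2 (R.pr_sec y) (R.pr_sec x)

/-- The local trivialization of `P ⊗_K G ⊗_K P⁻¹` over arrows from a neighbourhood of `x` to a
neighbourhood of `y`. -/
noncomputable def triv : OpenPartialHomeomorph (Twist X R) G where
  toFun := toArrow X R x y
  invFun := ofArrow X R x y
  source := {w | tgt X R w ∈ R.dom y ∧ src X R w ∈ R.dom x}
  target := {g | 𝒢.tgt g ∈ R.dom y ∧ 𝒢.src g ∈ R.dom x}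
  map_source' w hw := by
    simpa only [mem_ofPred_eq, src_toArrow, tgt_toArrow] using hw
  map_target' g hg := hg
  left_inv' w _ := ofArrow_toArrow X R x y w
  right_inv' g _ := toArrow_ofArrow X R x y g
  open_source := ((R.isOpen_dom y).preimage (continuous_tgt X R)).inter
    ((R.isOpen_dom x).preimage (continuous_src X R))
  open_target := ((R.isOpen_dom y).preimage 𝒢.isSubmersion_tgt.contMDiff.continuous).inter
    ((R.isOpen_dom x).preimage 𝒢.isSubmersion_src.contMDiff.continuous)
  continuousOn_toFun := by
    have hq : IsQuotientMap (Quot.mk (TwistRel X R) : Triple 𝒢 pr → Twist X R) :=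
      isQuotientMap_quot_mk
    have ho := ((R.isOpen_dom y).preimage (continuous_tgt X R)).inter
      ((R.isOpen_dom x).preimage (continuous_src X R))
    refine (hq.continuousOn_isOpen_iff ho).2 ?_
    exact (contMDiffOn_toAux (X := X) (R := R) (R.pr_sec y) (R.pr_sec x) (R.contMDiffOn_sec y)
      (R.contMDiffOn_sec x)).continuousOn.comp continuous_subtype_val.continuousOn
      (fun a ha => ⟨a.2.1, a.2.2, ha.1, ha.2⟩)
  continuousOn_invFun := by
    have h1 : ContinuousOn (fun g => R.sec y (𝒢.tgt g))
        {g | 𝒢.tgt g ∈ R.dom y ∧ 𝒢.src g ∈ R.dom x} :=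
      (R.contMDiffOn_sec y).continuousOn.comp
        𝒢.isSubmersion_tgt.contMDiff.continuous.continuousOn (fun g hg => hg.1)
    have h2 : ContinuousOn (fun g => R.sec x (𝒢.src g))
        {g | 𝒢.tgt g ∈ R.dom y ∧ 𝒢.src g ∈ R.dom x} :=
      (R.contMDiffOn_sec x).continuousOn.comp
        𝒢.isSubmersion_src.contMDiff.continuous.continuousOn (fun g hg => hg.2)
    refine continuous_quot_mk.comp_continuousOn (s := {g | 𝒢.tgt g ∈ R.dom y ∧ 𝒢.src g ∈ R.dom x})
      (f := fun g => (⟨(R.sec y (𝒢.tgt g), g, R.sec x (𝒢.src g)), R.pr_sec _ _, R.pr_sec _ _⟩ :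
        Triple 𝒢 pr)) ?_
    exact Topology.IsInducing.subtypeVal.continuousOn_iff.2 (h1.prodMk (continuousOn_id.prodMk h2))

/-- `P ⊗_K G ⊗_K P⁻¹` is locally modelled on `G`. -/
@[reducible] noncomputable def chartedSpaceArrow : ChartedSpace G (Twist X R) where
  atlas := {e | ∃ x y, e = triv X R x y}
  chartAt w := triv X R (src X R w) (tgt X R w)
  mem_chart_source _ := ⟨R.mem_dom _, R.mem_dom _⟩
  chart_mem_atlas _ := ⟨_, _, rfl⟩

/-- The charts of `P ⊗_K G ⊗_K P⁻¹`: the local trivializations followed by charts of `G`. -/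
noncomputable instance chartedSpace : ChartedSpace (EuclideanSpace ℝ (Fin dG)) (Twist X R) :=
  @ChartedSpace.comp (EuclideanSpace ℝ (Fin dG)) _ G _ (Twist X R) _ _ (chartedSpaceArrow X R)

/-- Changes of local trivialization are smooth. -/
theorem contMDiffOn_triv_change (x' y' : M) :
    ContMDiffOn (𝓡 dG) (𝓡 dG) ∞ ((triv X R x y).symm.trans (triv X R x' y'))
      ((triv X R x y).symm.trans (triv X R x' y')).source := by
  have ht := 𝒢.isSubmersion_tgt.contMDiff
  have hs := 𝒢.isSubmersion_src.contMDiff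
  have hS : ∀ g ∈ ((triv X R x y).symm.trans (triv X R x' y')).source,
      (𝒢.tgt g ∈ R.dom y ∧ 𝒢.src g ∈ R.dom x) ∧ (𝒢.tgt g ∈ R.dom y' ∧ 𝒢.src g ∈ R.dom x') := by
    intro g hg
    rw [OpenPartialHomeomorph.trans_source] at hg
    exact hg
  have h1 := (R.contMDiffOn_sec y).comp ht.contMDiffOn (fun g hg => (hS g hg).1.1)
  have h2 := (R.contMDiffOn_sec x).comp hs.contMDiffOn (fun g hg => (hS g hg).1.2)
  exact (contMDiffOn_toAux (X := X) (R := R) (R.pr_sec y') (R.pr_sec x') (R.contMDiffOn_sec y')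
    (R.contMDiffOn_sec x')).comp (h1.prodMk (contMDiffOn_id.prodMk h2))
    (fun g hg => ⟨R.pr_sec _ _, R.pr_sec _ _, (hS g hg).2.1, (hS g hg).2.2⟩)

/-- `P ⊗_K G ⊗_K P⁻¹` is a smooth manifold. -/
instance isManifold [IsManifold (𝓡 dG) ∞ G] : IsManifold (𝓡 dG) ∞ (Twist X R) := by
  apply isManifold_of_contDiffOn
  rintro e e' ⟨_, ⟨x, y, rfl⟩, c, hc, rfl⟩ ⟨_, ⟨x', y', rfl⟩, c', hc', rfl⟩
  have hc := IsManifold.subset_maximalAtlas (I := 𝓡 dG) (n := ∞) hc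
  have hc' := IsManifold.subset_maximalAtlas (I := 𝓡 dG) (n := ∞) hc'
  have h1 := contMDiffOn_symm_of_mem_maximalAtlas hc
  have h2 := contMDiffOn_of_mem_maximalAtlas hc'
  have h3 := contMDiffOn_triv_change X R x y x' y'
  rw [← contMDiffOn_iff_contDiffOn]
  set S := (((triv X R x y).trans c).symm.trans ((triv X R x' y').trans c')).source with hS
  have hmem : ∀ v ∈ S, v ∈ c.target ∧
      c.symm v ∈ ((triv X R x y).symm.trans (triv X R x' y')).source ∧
      ((triv X R x y).symm.trans (triv X R x' y')) (c.symm v) ∈ c'.source := by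
    intro v hv
    simp only [hS, OpenPartialHomeomorph.trans_source, OpenPartialHomeomorph.symm_source,
      OpenPartialHomeomorph.trans_target, mem_inter_iff, mem_preimage,
      OpenPartialHomeomorph.coe_trans_symm, Function.comp_apply] at hv
    obtain ⟨⟨a1, a2⟩, a3, a4⟩ := hv
    refine ⟨a1, ?_, a4⟩
    rw [OpenPartialHomeomorph.trans_source]
    exact ⟨a2, a3⟩
  exact (h2.comp (h3.comp (h1.mono (fun v hv => (hmem v hv).1)) (fun v hv => (hmem v hv).2.1))
    (fun v hv => (hmem v hv).2.2)).mono inter_subset_left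

end Twist

/-- The inclusion `j_P : L → P ⊗_K G ⊗_K P⁻¹`, `j_P(l) = l q ⊗ 1_x ⊗ q⁻¹` for any `q ∈ P_x`. -/
noncomputable def Twist.incl {dL : ℕ} {L : Type*} [TopologicalSpace L]
    [ChartedSpace (EuclideanSpace ℝ (Fin dL)) L] {ℒ : LieGroupBundle n dL M L}
    (X : Extension 𝒦 𝒢 ℰ) (B : Bitorsor dP ℒ 𝒦 P) (l : L) : Twist X B.right :=
  Twist.mk X B.right (B.left.act l (B.right.sec (ℒ.src l) (ℒ.src l))) (𝒢.unit (ℒ.src l))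
    (B.right.sec (ℒ.src l) (ℒ.src l))
    (by rw [B.left.pr_act _ _ (B.right.pr_sec _ _).symm, B.right.pr_sec, 𝒢.tgt_unit])
    (by rw [B.right.pr_sec, 𝒢.src_unit])

/-- The twisted extension `L → P ⊗_K G ⊗_K P⁻¹ → E`. -/
noncomputable def Extension.twist {dL : ℕ} {L : Type*} [TopologicalSpace L]
    [ChartedSpace (EuclideanSpace ℝ (Fin dL)) L] {ℒ : LieGroupBundle n dL M L}
    (X : Extension 𝒦 𝒢 ℰ) (B : Bitorsor dP ℒ 𝒦 P) :
    ExtDiagram ℒ.toGroupoidData (Twist.groupoidData X B.right) ℰ.toGroupoidData where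
  incl := Twist.incl X B
  proj := Twist.proj X B.right

end Twist

/-! ### Sections of bitorsors -/

section Sections

variable {n dK dL dG dE dP q : ℕ} {M K L G E P T : Type*}
  [TopologicalSpace M] [ChartedSpace (EuclideanSpace ℝ (Fin n)) M]
  [TopologicalSpace K] [ChartedSpace (EuclideanSpace ℝ (Fin dK)) K]
  [TopologicalSpace L] [ChartedSpace (EuclideanSpace ℝ (Fin dL)) L]
  [TopologicalSpace G] [ChartedSpace (EuclideanSpace ℝ (Fin dG)) G]
  [TopologicalSpace E] [ChartedSpace (EuclideanSpace ℝ (Fin dE)) E]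
  [TopologicalSpace P] [ChartedSpace (EuclideanSpace ℝ (Fin dP)) P]
  [TopologicalSpace T] [ChartedSpace (EuclideanSpace ℝ (Fin q)) T]
  {𝒦 : LieGroupBundle n dK M K} {ℒ : LieGroupBundle n dL M L}
  {𝒢 : LieGroupoid n dG M G} {ℰ : LieGroupoid n dE M E}

/-- A smooth section of `P` over `ι : T → M`. -/
@[ext] structure SectionOver (q : ℕ) {T : Type*} [TopologicalSpace T]
    [ChartedSpace (EuclideanSpace ℝ (Fin q)) T] (B : Bitorsor dP ℒ 𝒦 P) (ι : T → M) where
  toFun : T → P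
  contMDiff : ContMDiff (𝓡 q) (𝓡 dP) ∞ toFun
  pr_apply : ∀ a, B.pr (toFun a) = ι a

/-- A smooth global section of `P`. -/
abbrev GlobalSection (B : Bitorsor dP ℒ 𝒦 P) := SectionOver n B (id : M → M)

namespace SectionOver

variable {B : Bitorsor dP ℒ 𝒦 P} {ι : T → M}

/-- The conjugation `α(x) k α(x)⁻¹ ∈ L_x`, for `k ∈ K_x`, where `x = ι a`. -/
def conj (α : SectionOver q B ι) (a : T) (k : K) : L :=
  B.left.div (B.right.act (α.toFun a) k) (α.toFun a)

/-- The arrow `α(y) ⊗ g ⊗ α(x)⁻¹`, for `g : x → y` in `G`, where `x = ι a` and `y = ι b`. -/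
def hat (X : Extension 𝒦 𝒢 ℰ) (α : SectionOver q B ι) (a b : T) (g : G)
    (ha : 𝒢.src g = ι a) (hb : 𝒢.tgt g = ι b) : Twist X B.right :=
  Twist.mk X B.right (α.toFun b) g (α.toFun a) ((α.pr_apply b).trans hb.symm)
    ((α.pr_apply a).trans ha.symm)

/-- The section `β` over `M` restricts to `α` over `T`. -/
def Extends (β : GlobalSection B) (α : SectionOver q B ι) : Prop :=
  ∀ a, β.toFun (ι a) = α.toFun a

/-- The map `u` restricts to `α̂` on the restriction `G_T` of `G` to `T`. -/
def RestrictsToHat (X : Extension 𝒦 𝒢 ℰ) (α : SectionOver q B ι) (u : G → Twist X B.right) : Prop :=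
  ∀ (a b : T) (g : G) (ha : 𝒢.src g = ι a) (hb : 𝒢.tgt g = ι b), u g = α.hat X a b g ha hb

/-- The map `v` restricts to the conjugation by `α` on `K_T`. -/
def RestrictsToConj (α : SectionOver q B ι) (v : K → L) : Prop :=
  ∀ (a : T) (k : K), 𝒦.src k = ι a → v k = α.conj a k

/-- The conjugation `K → L` by a global section. -/
def conjMap (β : GlobalSection B) (k : K) : L := β.conj (𝒦.src k) k

/-- The map `β̂ : G → P ⊗_K G ⊗_K P⁻¹` of a global section `β`. -/
def hatMap (X : Extension 𝒦 𝒢 ℰ) (β : GlobalSection B) (g : G) : Twist X B.right :=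
  β.hat X (𝒢.src g) (𝒢.tgt g) g rfl rfl

/-- A section of a `K`-`K` bitorsor is central if conjugation by it is the identity. -/
def IsCentral {B : Bitorsor dP 𝒦 𝒦 P} (α : SectionOver q B ι) : Prop :=
  ∀ (a : T) (k : K), 𝒦.src k = ι a → α.conj a k = k

end SectionOver

end Sections

end LieExt

/-!
Given a section `β` of `P` over `M`, the map `β̂` is a bijection with inverse
`q ⊗ g ⊗ p⁻¹ ↦ (β(t g)⁻¹ q) g (p⁻¹ β(s g))`; both are smooth because in the local trivializations
of the twisted groupoid they are given by the division map, the inclusion of `K` and the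
composition of `G` (`SectionOver.isExtIso`).

Conversely, let `(v, u)` be an isomorphism of extensions with `u = α̂` on `G_T`. An arrow
`k : x → y` with `y ∈ T` has the same image in `E` as `u(k)`, so by exactness
`u(k) = α(y) ⊗ k ⊗ b⁻¹` for a unique `b ∈ P_x` (`Twist.exists_eq_mk_of_proj_eq`,
`Twist.mk_right_injective`). Two arrows from `x` into `T` differ by an arrow of `G_T`, where `u` is
known, so `b = b(x)` depends only on `x` (`IsExtIso.exists_setSection`). Every `x` is joined to `T`,
hence `b` is defined on all of `M`. Computing `u(k g) = u(k) u(g)` for `k` ending in `T` shows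
`u = b̂`, and then `v = b̄` because `j_P` is injective.

The remaining point is the smoothness of `b` (`contMDiff_of_eq_mk`). Transversality provides, near
each point, a smooth family of arrows `κ(x)` from `x` to a point of `T`
(`IsCompleteTransversal.exists_smooth_arrows`): the differential of the target map, restricted to
the arrows starting in `T`, is surjective at the units over `T`. In a trivialization, `u(κ(x))`
is then the product of an arrow depending smoothly on `x` and of the image in `G` of the element of
`K` which determines `b(x)`; that element is smooth in `x` because `K` is embedded in `G`.
-/

namespace LieExt

/-! ### Submersions and transversals -/

section Submersions

variable {n d q : ℕ} {M G T : Type*}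
  [TopologicalSpace M] [ChartedSpace (EuclideanSpace ℝ (Fin n)) M]
  [TopologicalSpace G] [ChartedSpace (EuclideanSpace ℝ (Fin d)) G]
  [TopologicalSpace T] [ChartedSpace (EuclideanSpace ℝ (Fin q)) T]

/-- Near a point `g` where `f` is a submersion, points can be moved smoothly into prescribed
fibres of `f`: `c (y, h)` lies over `y`, and `c (f h, h) = h`. -/
theorem exists_move_to_fibre {f : G → M} {g : G}
    (hf : Manifold.IsSubmersionAt (𝓡 d) (𝓡 n) ∞ f g) :
    ∃ c : M × G → G, ContMDiffAt ((𝓡 n).prod (𝓡 d)) (𝓡 d) ∞ c (f g, g) ∧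
      (∀ᶠ a in 𝓝 (f g, g), f (c a) = a.1) ∧ ∀ᶠ h in 𝓝 g, c (f h, h) = h := by
  set φ := hf.domChart
  set ψ := hf.codChart
  have hg : g ∈ φ.source := hf.mem_domChart_source
  have hy : f g ∈ ψ.source := hf.mem_codChart_source
  have hsub : ∀ h ∈ φ.source, f h ∈ ψ.source := fun h hh => hf.source_subset_preimage_source hh
  have hw : ∀ v ∈ φ.target, ψ (f (φ.symm v)) = (hf.equiv v).1 := by
    intro v hv
    have hv' : v ∈ (φ.extend (𝓡 d)).target := by simpa using hv
    exact hf.writtenInCharts hv'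
  have hw' : ∀ h ∈ φ.source, ψ (f h) = (hf.equiv (φ h)).1 := fun h hh => by
    rw [← hw _ (φ.map_source hh), φ.left_inv hh]
  -- In charts adapted to `f`, replace the first coordinate of `h` by that of `y`.
  let A : EuclideanSpace ℝ (Fin n) × EuclideanSpace ℝ (Fin d) → EuclideanSpace ℝ (Fin d) :=
    fun v => hf.equiv.symm (v.1, (hf.equiv v.2).2)
  let B : M × G → EuclideanSpace ℝ (Fin d) := fun a => A (ψ a.1, φ a.2)
  have hA : ContDiff ℝ ∞ A := by
    refine hf.equiv.symm.contDiff.comp (contDiff_fst.prodMk ?_)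
    exact contDiff_snd.comp (hf.equiv.contDiff.comp contDiff_snd)
  have hB0 : ∀ h ∈ φ.source, B (f h, h) = φ h := fun h hh => by
    change hf.equiv.symm (ψ (f h), (hf.equiv (φ h)).2) = φ h
    rw [hw' h hh, Prod.mk.eta, ContinuousLinearEquiv.symm_apply_apply]
  have h1 : ContMDiffAt ((𝓡 n).prod (𝓡 d)) (𝓡 n) ∞ (fun a : M × G => ψ a.1) (f g, g) :=
    (contMDiffAt_of_mem_maximalAtlas hf.codChart_mem_maximalAtlas hy).comp (f g, g)
      contMDiffAt_fst
  have h2 : ContMDiffAt ((𝓡 n).prod (𝓡 d)) (𝓡 d) ∞ (fun a : M × G => φ a.2) (f g, g) :=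
    (contMDiffAt_of_mem_maximalAtlas hf.domChart_mem_maximalAtlas hg).comp (f g, g)
      contMDiffAt_snd
  have hB : ContMDiffAt ((𝓡 n).prod (𝓡 d)) (𝓡 d) ∞ B (f g, g) :=
    hA.contMDiff.contMDiffAt.comp (f g, g) (h1.prodMk_space h2)
  have hBt : B (f g, g) ∈ φ.target := by rw [hB0 g hg]; exact φ.map_source hg
  refine ⟨fun a => φ.symm (B a), ?_, ?_, ?_⟩
  · exact (contMDiffAt_symm_of_mem_maximalAtlas hf.domChart_mem_maximalAtlas hBt).comp (f g, g) hB
  · have e1 := hB.continuousAt.preimage_mem_nhds (φ.open_target.mem_nhds hBt)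
    have e2 : ∀ᶠ a : M × G in 𝓝 (f g, g), a.1 ∈ ψ.source :=
      continuousAt_fst.preimage_mem_nhds (ψ.open_source.mem_nhds hy)
    filter_upwards [e1, e2] with a ha ha'
    refine ψ.injOn (hsub _ (φ.map_target ha)) ha' ?_
    rw [hw _ ha]
    change (hf.equiv (hf.equiv.symm _)).1 = _
    rw [ContinuousLinearEquiv.apply_symm_apply]
  · filter_upwards [φ.open_source.mem_nhds hg] with h hh
    rw [hB0 h hh, φ.left_inv hh]

/-- A submersion has a smooth local section through every point. -/
theorem exists_section_through {f : G → M} {g : G}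
    (hf : Manifold.IsSubmersionAt (𝓡 d) (𝓡 n) ∞ f g) :
    ∃ σ : M → G, ContMDiffAt (𝓡 n) (𝓡 d) ∞ σ (f g) ∧ σ (f g) = g ∧
      ∀ᶠ y in 𝓝 (f g), f (σ y) = y := by
  obtain ⟨c, hc, h1, h2⟩ := exists_move_to_fibre hf
  refine ⟨fun y => c (y, g), ContMDiffAt.comp (f g) hc (contMDiffAt_id.prodMk contMDiffAt_const),
    h2.self_of_nhds, ?_⟩
  exact (Continuous.prodMk_left g).continuousAt.eventually h1

/-- A smooth map with surjective differential at `p` has a smooth local right inverse which maps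
its value at `p` to `p`. -/
theorem exists_rightInverse_of_surjective_mfderiv {V H N : Type*} [NormedAddCommGroup V]
    [NormedSpace ℝ V] [FiniteDimensional ℝ V] [TopologicalSpace H]
    {I : ModelWithCorners ℝ V H} [I.Boundaryless]
    [TopologicalSpace N] [ChartedSpace H N] [IsManifold I ∞ N] [IsManifold (𝓡 n) ∞ M]
    {f : N → M} {p : N} (hf : ContMDiffAt I (𝓡 n) ∞ f p)
    (hs : Function.Surjective (mfderiv I (𝓡 n) f p)) :
    ∃ σ : M → N, ContMDiffAt (𝓡 n) I ∞ σ (f p) ∧ σ (f p) = p ∧ ∀ᶠ y in 𝓝 (f p), f (σ y) = y := by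
  set φ := extChartAt I p with hφ
  set ψ := extChartAt (𝓡 n) (f p)
  set F : V → EuclideanSpace ℝ (Fin n) := ψ ∘ f ∘ φ.symm with hF
  have hmd : MDifferentiableAt I (𝓡 n) f p := hf.mdifferentiableAt (by simp)
  have hFs : ContDiffAt ℝ ∞ F (φ p) := by
    have := (contMDiffAt_iff.1 hf).2
    rwa [I.range_eq_univ, contDiffWithinAt_univ] at this
  set D : V →L[ℝ] EuclideanSpace ℝ (Fin n) := mfderiv I (𝓡 n) f p
  have hFd : HasFDerivAt F D (φ p) := by
    have h : HasFDerivWithinAt F D (range I) (φ p) := hmd.hasMFDerivAt.2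
    rwa [I.range_eq_univ, hasFDerivWithinAt_univ] at h
  obtain ⟨R, hR⟩ := D.toLinearMap.exists_rightInverse_of_surjective (LinearMap.range_eq_top.2 hs)
  -- The inverse function theorem applies to the restriction of `f` to an affine subspace,
  -- parametrized by a right inverse of the differential.
  let A : EuclideanSpace ℝ (Fin n) → V := fun v => φ p + R.toContinuousLinearMap v
  have hA : ContDiff ℝ ∞ A := contDiff_const.add R.toContinuousLinearMap.contDiff
  have hA0 : A 0 = φ p := by simp [A]
  have hAd : HasFDerivAt A R.toContinuousLinearMap 0 :=
    R.toContinuousLinearMap.hasFDerivAt.const_add _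
  have hFA : ContDiffAt ℝ ∞ (F ∘ A) 0 := ContDiffAt.comp 0 (by rwa [hA0]) hA.contDiffAt
  have hFAd : HasFDerivAt (F ∘ A)
      ((ContinuousLinearEquiv.refl ℝ (EuclideanSpace ℝ (Fin n)) :
        EuclideanSpace ℝ (Fin n) →L[ℝ] EuclideanSpace ℝ (Fin n))) 0 := by
    have h := HasFDerivAt.comp (g := F) (0 : EuclideanSpace ℝ (Fin n)) (by rw [hA0]; exact hFd) hAd
    have e : D.comp R.toContinuousLinearMap = ContinuousLinearMap.id ℝ _ := by
      ext1 v
      exact LinearMap.congr_fun hR v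
    rwa [e] at h
  have hinf : (∞ : WithTop ℕ∞) ≠ 0 := by simp
  have h0 : (F ∘ A) 0 = ψ (f p) := by
    simp [hF, hA0, hφ]
  set r := hFA.localInverse hFAd hinf
  have hrs : ContDiffAt ℝ ∞ r (ψ (f p)) := h0 ▸ hFA.to_localInverse hFAd hinf
  have hr0 : r (ψ (f p)) = 0 := by
    have := hFA.localInverse_apply_image hFAd hinf
    rwa [h0] at this
  have hrr : ∀ᶠ v in 𝓝 (ψ (f p)), (F ∘ A) (r v) = v := by
    have := (hFA.hasStrictFDerivAt' hFAd hinf).eventually_right_inverse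
    rwa [h0] at this
  have hψs : ContMDiffAt (𝓡 n) (𝓡 n) ∞ ψ (f p) := contMDiffAt_extChartAt
  have hAr : ContMDiffAt (𝓡 n) 𝓘(ℝ, V) ∞ (fun y => A (r (ψ y))) (f p) :=
    (hA.contDiffAt.comp _ hrs).contMDiffAt.comp (f p) hψs
  have hAr0 : A (r (ψ (f p))) = φ p := by rw [hr0, hA0]
  have hφs : ContMDiffAt 𝓘(ℝ, V) I ∞ φ.symm (φ p) :=
    (contMDiffOn_extChartAt_symm p).contMDiffAt (extChartAt_target_mem_nhds p)
  have hσ : ContMDiffAt (𝓡 n) I ∞ (fun y => φ.symm (A (r (ψ y)))) (f p) :=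
    ContMDiffAt.comp (f p) (by rwa [hAr0]) hAr
  have hσ0 : φ.symm (A (r (ψ (f p)))) = p := by
    rw [hAr0]; exact extChartAt_to_inv p
  refine ⟨fun y => φ.symm (A (r (ψ y))), hσ, hσ0, ?_⟩
  have e1 : ∀ᶠ y in 𝓝 (f p), f (φ.symm (A (r (ψ y)))) ∈ ψ.source := by
    have hc : ContinuousAt (fun y => f (φ.symm (A (r (ψ y))))) (f p) :=
      ContinuousAt.comp (by rw [hσ0]; exact hf.continuousAt) hσ.continuousAt
    refine hc.preimage_mem_nhds ?_
    rw [hσ0]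
    exact extChartAt_source_mem_nhds (f p)
  filter_upwards [hψs.continuousAt.eventually hrr, e1, extChartAt_source_mem_nhds (I := 𝓡 n) (f p)]
    with y hy1 hy2 hy3
  exact ψ.injOn hy2 hy3 hy1

/-- If every tangent vector `ζ` at `t g` is the image under `dt` of some `ξ` such that `df ξ` is
tangent to `ι`, then near `t g` there is a smooth family of points `Γ y` with `t (Γ y) = y` such
that `f (Γ y)` stays on `ι`. -/
theorem exists_section_over_transversal [IsManifold (𝓡 n) ∞ M] [IsManifold (𝓡 d) ∞ G]
    [IsManifold (𝓡 q) ∞ T] {f t : G → M} {g : G} {ι : T → M} {a : T}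
    (hf : Manifold.IsSubmersionAt (𝓡 d) (𝓡 n) ∞ f g) (ht : ContMDiffAt (𝓡 d) (𝓡 n) ∞ t g)
    (hι : ContMDiffAt (𝓡 q) (𝓡 n) ∞ ι a) (h : f g = ι a)
    {df dt : EuclideanSpace ℝ (Fin d) →L[ℝ] EuclideanSpace ℝ (Fin n)}
    {dι : EuclideanSpace ℝ (Fin q) →L[ℝ] EuclideanSpace ℝ (Fin n)}
    (hdf : HasMFDerivAt (𝓡 d) (𝓡 n) f g df) (hdt : HasMFDerivAt (𝓡 d) (𝓡 n) t g dt)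
    (hdι : HasMFDerivAt (𝓡 q) (𝓡 n) ι a dι) (hs : ∀ ζ, ∃ w ξ, df ξ = dι w ∧ dt ξ = ζ) :
    ∃ (A : M → T) (Γ : M → G), ContMDiffAt (𝓡 n) (𝓡 q) ∞ A (t g) ∧
      ContMDiffAt (𝓡 n) (𝓡 d) ∞ Γ (t g) ∧ ∀ᶠ y in 𝓝 (t g), t (Γ y) = y ∧ f (Γ y) = ι (A y) := by
  obtain ⟨c, hc, hc1, hc2⟩ := exists_move_to_fibre hf
  have hcg : c (f g, g) = g := hc2.self_of_nhds
  have hcd : HasMFDerivAt ((𝓡 n).prod (𝓡 d)) (𝓡 d) c (f g, g) _ :=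
    (hc.mdifferentiableAt (by simp)).hasMFDerivAt
  -- As `c (f x, x) = x`, the differential of `c` maps `(df ξ, ξ)` to `ξ`.
  set dc : EuclideanSpace ℝ (Fin n) × EuclideanSpace ℝ (Fin d) →L[ℝ] EuclideanSpace ℝ (Fin d) :=
    mfderiv ((𝓡 n).prod (𝓡 d)) (𝓡 d) c (f g, g)
  have hdc : ∀ ξ, dc (df ξ, ξ) = ξ := by
    have h1 : HasMFDerivAt (𝓡 d) (𝓡 d) (fun x => c (f x, x)) g
        (dc.comp (df.prod (ContinuousLinearMap.id ℝ _))) :=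
      HasMFDerivAt.comp (g := c) g hcd (hdf.prodMk (hasMFDerivAt_id g))
    have h2 : HasMFDerivAt (𝓡 d) (𝓡 d) (fun x => c (f x, x)) g
        (ContinuousLinearMap.id ℝ (EuclideanSpace ℝ (Fin d))) :=
      (hasMFDerivAt_id g).congr_of_eventuallyEq hc2
    intro ξ
    exact DFunLike.congr_fun (hasMFDerivAt_unique h1 h2) ξ
  have hm : ContMDiffAt ((𝓡 q).prod (𝓡 d)) ((𝓡 n).prod (𝓡 d)) ∞
      (fun b : T × G => (ι b.1, b.2)) (a, g) :=
    (ContMDiffAt.comp (a, g) (g := ι) hι contMDiffAt_fst).prodMk contMDiffAt_snd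
  have hmd : HasMFDerivAt ((𝓡 q).prod (𝓡 d)) ((𝓡 n).prod (𝓡 d))
      (fun b : T × G => (ι b.1, b.2)) (a, g)
      ((dι.comp (ContinuousLinearMap.fst ℝ _ _)).prod (ContinuousLinearMap.snd ℝ _ _)) :=
    (HasMFDerivAt.comp (g := ι) (a, g) hdι (hasMFDerivAt_fst (a, g))).prodMk
      (hasMFDerivAt_snd (a, g))
  -- It suffices to show that `(b, x) ↦ t (c (ι b, x))` has surjective differential.
  let Φ : T × G → G := fun b => c (ι b.1, b.2)
  have hΦ0 : Φ (a, g) = g := by change c (ι a, g) = g; rw [← h, hcg]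
  have hΦ : ContMDiffAt ((𝓡 q).prod (𝓡 d)) (𝓡 d) ∞ Φ (a, g) :=
    ContMDiffAt.comp (a, g) (g := c) (by rw [← h]; exact hc) hm
  have hΦd : HasMFDerivAt ((𝓡 q).prod (𝓡 d)) (𝓡 d) Φ (a, g) (dc.comp
      ((dι.comp (ContinuousLinearMap.fst ℝ _ _)).prod (ContinuousLinearMap.snd ℝ _ _))) :=
    HasMFDerivAt.comp (g := c) (a, g) (by rw [← h]; exact hcd) hmd
  have htΦ : ContMDiffAt ((𝓡 q).prod (𝓡 d)) (𝓡 n) ∞ (t ∘ Φ) (a, g) :=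
    ContMDiffAt.comp (a, g) (by rw [hΦ0]; exact ht) hΦ
  have htΦd : HasMFDerivAt ((𝓡 q).prod (𝓡 d)) (𝓡 n) (t ∘ Φ) (a, g) (dt.comp (dc.comp
      ((dι.comp (ContinuousLinearMap.fst ℝ _ _)).prod (ContinuousLinearMap.snd ℝ _ _)))) :=
    HasMFDerivAt.comp (a, g) (by rw [hΦ0]; exact hdt) hΦd
  have e : (t ∘ Φ) (a, g) = t g := congrArg t hΦ0
  obtain ⟨σ, hσ, hσ0, hσ1⟩ := exists_rightInverse_of_surjective_mfderiv htΦ (by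
    rw [htΦd.mfderiv]
    intro ζ
    obtain ⟨w, ξ, h1, h2⟩ := hs ζ
    refine ⟨(w, ξ), ?_⟩
    change dt (dc (dι w, ξ)) = ζ
    rw [← h1, hdc, h2])
  rw [e] at hσ hσ0 hσ1
  refine ⟨fun y => (σ y).1, fun y => Φ (σ y), contMDiffAt_fst.comp (t g) hσ,
    ContMDiffAt.comp (t g) (g := Φ) (by rw [hσ0]; exact hΦ) hσ, ?_⟩
  have h3 : ContinuousAt (fun y => (ι (σ y).1, (σ y).2)) (t g) :=
    ContinuousAt.comp (g := fun b : T × G => (ι b.1, b.2)) (by rw [hσ0]; exact hm.continuousAt)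
      hσ.continuousAt
  have h4 : ∀ᶠ y in 𝓝 (t g), f (c (ι (σ y).1, (σ y).2)) = ι (σ y).1 := by
    have h5 : ∀ᶠ b in 𝓝 (ι (σ (t g)).1, (σ (t g)).2), f (c b) = b.1 := by
      rw [hσ0, ← h]
      exact hc1
    exact h3.eventually h5
  exact hσ1.and h4

/-- Near a point `ι a` of a transversal, the points `y` of `M` are joined to the transversal by
arrows `Γ y` depending smoothly on `y`. -/
theorem IsCompleteTransversal.exists_smooth_arrows [IsManifold (𝓡 n) ∞ M] [IsManifold (𝓡 d) ∞ G]
    [IsManifold (𝓡 q) ∞ T] {𝒢 : LieGroupoid n d M G} {ι : T → M}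
    (hι : IsCompleteTransversal q 𝒢 ι) (a : T) :
    ∃ (A : M → T) (Γ : M → G), ContMDiffAt (𝓡 n) (𝓡 q) ∞ A (ι a) ∧
      ContMDiffAt (𝓡 n) (𝓡 d) ∞ Γ (ι a) ∧
      ∀ᶠ y in 𝓝 (ι a), 𝒢.tgt (Γ y) = y ∧ 𝒢.src (Γ y) = ι (A y) := by
  set g := 𝒢.unit (ι a)
  have hιa : ContMDiffAt (𝓡 q) (𝓡 n) ∞ ι a := hι.isImmersion.contMDiff.contMDiffAt
  have hs := 𝒢.isSubmersion_src.contMDiff.contMDiffAt (x := g)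
  have ht := 𝒢.isSubmersion_tgt.contMDiff.contMDiffAt (x := g)
  have hu := 𝒢.contMDiff_unit.contMDiffAt (x := ι a)
  have hsd := (hs.mdifferentiableAt (by simp)).hasMFDerivAt
  have htd := (ht.mdifferentiableAt (by simp)).hasMFDerivAt
  have hud := (hu.mdifferentiableAt (by simp)).hasMFDerivAt
  have hιd := (hιa.mdifferentiableAt (by simp)).hasMFDerivAt
  set ds : EuclideanSpace ℝ (Fin d) →L[ℝ] EuclideanSpace ℝ (Fin n) :=
    mfderiv (𝓡 d) (𝓡 n) 𝒢.src g
  set dt : EuclideanSpace ℝ (Fin d) →L[ℝ] EuclideanSpace ℝ (Fin n) :=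
    mfderiv (𝓡 d) (𝓡 n) 𝒢.tgt g
  set du : EuclideanSpace ℝ (Fin n) →L[ℝ] EuclideanSpace ℝ (Fin d) :=
    mfderiv (𝓡 n) (𝓡 d) 𝒢.unit (ι a)
  set dι : EuclideanSpace ℝ (Fin q) →L[ℝ] EuclideanSpace ℝ (Fin n) :=
    mfderiv (𝓡 q) (𝓡 n) ι a
  have key : ∀ {r : G → M} {dr : EuclideanSpace ℝ (Fin d) →L[ℝ] EuclideanSpace ℝ (Fin n)},
      (∀ y, r (𝒢.unit y) = y) → HasMFDerivAt (𝓡 d) (𝓡 n) r g dr → ∀ w, dr (du w) = w := by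
    intro r dr hr hrd w
    have h1 : HasMFDerivAt (𝓡 n) (𝓡 n) (r ∘ 𝒢.unit) (ι a) (dr.comp du) := hrd.comp (ι a) hud
    have h2 : r ∘ 𝒢.unit = id := funext hr
    rw [h2] at h1
    exact DFunLike.congr_fun (hasMFDerivAt_unique h1 (hasMFDerivAt_id (ι a))) w
  -- `ζ = dι w + dt ξ` with `ds ξ = 0`; the vector `du (dι w) + ξ` is tangent to `s⁻¹(ι T)` and
  -- is mapped to `ζ` by `dt`.
  have hsup : ∀ ζ : EuclideanSpace ℝ (Fin n), ∃ w ξ, ds ξ = 0 ∧ dι w + dt ξ = ζ := by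
    have h : ∀ ζ : TangentSpace (𝓡 n) (ι a), ζ ∈
        LinearMap.range (mfderiv (𝓡 q) (𝓡 n) ι a).toLinearMap ⊔ 𝒢.orbitTangent (ι a) := by
      intro ζ
      rw [(hι.isCompl a).sup_eq_top]
      exact Submodule.mem_top
    intro ζ
    obtain ⟨_, ⟨w, rfl⟩, _, ⟨ξ, hξ, rfl⟩, h3⟩ := Submodule.mem_sup.1 (h ζ)
    exact ⟨w, ξ, hξ, h3⟩
  obtain ⟨A, Γ, hA, hΓ, h⟩ := exists_section_over_transversal
    (𝒢.isSubmersion_src.isSubmersionAt g) ht hιa (𝒢.src_unit _) hsd htd hιd (by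
    intro ζ
    obtain ⟨w, ξ, hξ0, h3⟩ := hsup ζ
    refine ⟨w, du (dι w) + ξ, ?_, ?_⟩
    · rw [map_add, key 𝒢.src_unit hsd, hξ0, add_zero]
    · rw [map_add, key 𝒢.tgt_unit htd]
      exact h3)
  have e : 𝒢.tgt g = ι a := 𝒢.tgt_unit _
  rw [e] at hA hΓ h
  exact ⟨A, Γ, hA, hΓ, h⟩

end Submersions

/-- A map which is smooth on a set, evaluated along a smooth family of points of that set. -/
theorem contMDiffAt_comp_of_eventually_mem {d d' : ℕ} {V H N A B : Type*}
    [NormedAddCommGroup V] [NormedSpace ℝ V] [TopologicalSpace H] {J : ModelWithCorners ℝ V H}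
    [TopologicalSpace N] [ChartedSpace (EuclideanSpace ℝ (Fin d)) N]
    [TopologicalSpace A] [ChartedSpace H A]
    [TopologicalSpace B] [ChartedSpace (EuclideanSpace ℝ (Fin d')) B]
    {F : A → B} {S : Set A} (hF : ContMDiffOn J (𝓡 d') ∞ F S) {f : N → A} {x : N}
    (hf : ContMDiffAt (𝓡 d) J ∞ f x) (h : ∀ᶠ y in 𝓝 x, f y ∈ S) :
    ContMDiffAt (𝓡 d) (𝓡 d') ∞ (fun y => F (f y)) x :=
  ((hF _ h.self_of_nhds).comp x hf.contMDiffWithinAt (fun _ hy => hy)).contMDiffAt h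

section

variable {n dK dG dE dP : ℕ} {M K G E P : Type*}
  [TopologicalSpace M] [ChartedSpace (EuclideanSpace ℝ (Fin n)) M]
  [TopologicalSpace K] [ChartedSpace (EuclideanSpace ℝ (Fin dK)) K]
  [TopologicalSpace G] [ChartedSpace (EuclideanSpace ℝ (Fin dG)) G]
  [TopologicalSpace E] [ChartedSpace (EuclideanSpace ℝ (Fin dE)) E]
  [TopologicalSpace P] [ChartedSpace (EuclideanSpace ℝ (Fin dP)) P]
  {𝒦 : LieGroupBundle n dK M K} {𝒢 : LieGroupoid n dG M G} {ℰ : LieGroupoid n dE M E}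
  {pr : P → M}

/-! ### Computing in the twisted groupoid -/

/-- By exactness, two arrows of `G` with the same image in `E` differ by an element of `K`. -/
theorem Extension.exists_eq_mul_incl (X : Extension 𝒦 𝒢 ℰ) {g g' : G}
    (hs : 𝒢.src g' = 𝒢.src g) (ht : 𝒢.tgt g' = 𝒢.tgt g) (h : X.proj g' = X.proj g) :
    ∃ l, 𝒦.src l = 𝒢.src g ∧ g' = 𝒢.mul g (X.incl l) := by
  have c : 𝒢.src (𝒢.inv g) = 𝒢.tgt g' := by rw [𝒢.src_inv, ht]
  obtain ⟨l, hl⟩ := (X.exact (𝒢.mul (𝒢.inv g) g')).1 ⟨𝒢.src g, by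
    rw [X.isHom_proj.map_mul _ _ c, X.isHom_proj.map_inv, h, ℰ.inv_mul, X.isHom_proj.map_src]⟩
  refine ⟨l, ?_, ?_⟩
  · rw [← Twist.src_incl X, hl, 𝒢.src_mul _ _ c, hs]
  · rw [hl, 𝒢.mul_inv_cancel_left _ _ ht.symm]

namespace Twist

variable {X : Extension 𝒦 𝒢 ℰ} {R : RightTorsor dP 𝒦 P pr}

theorem mk_act_left {q p : P} {g : G} {k : K} (hk : 𝒦.src k = 𝒢.tgt g)
    (h1 : pr (R.act q k) = 𝒢.tgt g) (h2 : pr p = 𝒢.src g)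
    (h3 : pr q = 𝒢.tgt (𝒢.mul (X.incl k) g)) (h4 : pr p = 𝒢.src (𝒢.mul (X.incl k) g)) :
    mk X R (R.act q k) g p h1 h2 = mk X R q (𝒢.mul (X.incl k) g) p h3 h4 :=
  Quot.sound (TwistRel.left _ _ k hk rfl rfl rfl)

theorem mk_mul_incl {q p : P} {g : G} {l : K} (hl : 𝒦.src l = 𝒢.src g)
    (h1 : pr q = 𝒢.tgt (𝒢.mul g (X.incl l))) (h2 : pr p = 𝒢.src (𝒢.mul g (X.incl l)))
    (h3 : pr q = 𝒢.tgt g) (h4 : pr (R.act p (𝒦.inv l)) = 𝒢.src g) :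
    mk X R q (𝒢.mul g (X.incl l)) p h1 h2 = mk X R q g (R.act p (𝒦.inv l)) h3 h4 :=
  Quot.sound (TwistRel.right _ _ l hl rfl rfl rfl)

theorem mul_mk_mk {r q p : P} {h g : G} (e : 𝒢.src h = 𝒢.tgt g) (h1 : pr r = 𝒢.tgt h)
    (h2 : pr q = 𝒢.src h) (h3 : pr q = 𝒢.tgt g) (h4 : pr p = 𝒢.src g) :
    mul X R (mk X R r h q h1 h2) (mk X R q g p h3 h4) =
      mk X R r (𝒢.mul h g) p (by rw [𝒢.tgt_mul _ _ e, h1]) (by rw [𝒢.src_mul _ _ e, h4]) := by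
  refine (mulAux_pos (X := X) (R := R) (a := ⟨(r, h, q), h1, h2⟩) (b := ⟨(q, g, p), h3, h4⟩)
    e).trans (mk_congr rfl ?_ rfl _ _ _ _)
  change 𝒢.mul (𝒢.mul h (X.incl (R.div q q))) g = _
  rw [R.div_self, X.isHom_incl.map_unit, h2, 𝒢.mul_unit]

/-- For `p, q` in the same fibre, `q ⊗ 1 ⊗ p⁻¹` only depends on the pair `(q, p)` up to the
diagonal action of `K`. -/
theorem mk_unit_act {q p : P} {k : K} {x : M} (hk : 𝒦.src k = x)
    (h1 : pr (R.act q k) = 𝒢.tgt (𝒢.unit x)) (h2 : pr (R.act p k) = 𝒢.src (𝒢.unit x))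
    (h3 : pr q = 𝒢.tgt (𝒢.unit x)) (h4 : pr p = 𝒢.src (𝒢.unit x)) :
    mk X R (R.act q k) (𝒢.unit x) (R.act p k) h1 h2 = mk X R q (𝒢.unit x) p h3 h4 := by
  have hx := 𝒢.src_unit x
  have hx' := 𝒢.tgt_unit x
  have e1 : 𝒢.mul (X.incl k) (𝒢.unit x) = X.incl k := by
    rw [← hk, ← src_incl X, 𝒢.mul_unit]
  have e2 : 𝒢.mul (𝒢.unit x) (X.incl k) = X.incl k := by
    rw [← hk, ← tgt_incl X, 𝒢.unit_mul]
  have s : 𝒢.src (X.incl k) = x := (src_incl X k).trans hk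
  have t : 𝒢.tgt (X.incl k) = x := (tgt_incl X k).trans hk
  have pk : R.act (R.act p k) (𝒦.inv k) = p := by
    rw [R.act_mul _ _ _ (by rw [h4, hx, hk]) (by rw [h4, hx, 𝒦.src_inv, 𝒦.tgt_eq_src, hk]),
      𝒦.mul_inv, 𝒦.tgt_eq_src, hk, ← hx, ← h4, R.act_unit]
  rw [mk_act_left (hk.trans hx'.symm) h1 h2 (by rw [e1, t, h3, hx']) (by rw [e1, s, h2, hx]),
    mk_congr rfl (e1.trans e2.symm) rfl _ _ (by rw [e2, t, h3, hx']) (by rw [e2, s, h2, hx]),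
    mk_mul_incl (hk.trans hx.symm) _ _ h3 (by rw [pk, h4])]
  exact mk_congr rfl rfl pk _ _ _ _

/-- Once representatives `q` and `p` of the end points are chosen, every arrow of the twisted
groupoid is of the form `q ⊗ g ⊗ p⁻¹`. -/
theorem exists_eq_mk (w : Twist X R) {q p : P} (hq : pr q = tgt X R w) (hp : pr p = src X R w) :
    ∃ (g : G) (h1 : pr q = 𝒢.tgt g) (h2 : pr p = 𝒢.src g), w = mk X R q g p h1 h2 := by
  induction w using Quot.ind with
  | mk a =>
    obtain ⟨⟨q₀, g₀, p₀⟩, h1, h2⟩ := a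
    change pr q₀ = 𝒢.tgt g₀ at h1
    change pr p₀ = 𝒢.src g₀ at h2
    change pr q = 𝒢.tgt g₀ at hq
    change pr p = 𝒢.src g₀ at hp
    have e1 : pr q = pr q₀ := hq.trans h1.symm
    have e2 : pr p = pr p₀ := hp.trans h2.symm
    have k1 : 𝒦.src (R.div q q₀) = 𝒢.tgt g₀ := (R.src_div _ _ e1).trans hq
    have k2 : 𝒦.src (R.div p₀ p) = 𝒢.src g₀ := (R.src_div _ _ e2.symm).trans h2
    have c1 : 𝒢.src (X.incl (R.div q q₀)) = 𝒢.tgt g₀ := (src_incl X _).trans k1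
    set g₁ := 𝒢.mul (X.incl (R.div q q₀)) g₀ with hg₁
    have s1 : 𝒢.src g₁ = 𝒢.src g₀ := 𝒢.src_mul _ _ c1
    have t1 : 𝒢.tgt g₁ = 𝒢.tgt g₀ := by rw [hg₁, 𝒢.tgt_mul _ _ c1, tgt_incl, k1]
    have c2 : 𝒢.src g₁ = 𝒢.tgt (X.incl (R.div p₀ p)) := by rw [tgt_incl, k2, s1]
    have s2 : 𝒢.src (𝒢.mul g₁ (X.incl (R.div p₀ p))) = 𝒢.src g₀ := by
      rw [𝒢.src_mul _ _ c2, src_incl, k2]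
    have t2 : 𝒢.tgt (𝒢.mul g₁ (X.incl (R.div p₀ p))) = 𝒢.tgt g₀ := (𝒢.tgt_mul _ _ c2).trans t1
    have e3 : R.act p (𝒦.inv (R.div p₀ p)) = p₀ := by rw [R.div_inv _ _ e2.symm, R.act_div _ _ e2]
    refine ⟨𝒢.mul g₁ (X.incl (R.div p₀ p)), hq.trans t2.symm, hp.trans s2.symm, ?_⟩
    rw [mk_mul_incl (k2.trans s1.symm) _ _ (hq.trans t1.symm) (by rw [e3, h2, s1]),
      mk_congr rfl rfl e3 _ _ (hq.trans t1.symm) (h2.trans s1.symm),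
      ← mk_act_left k1 (by rw [R.act_div _ _ e1, h1]) h2]
    exact mk_congr (R.act_div _ _ e1).symm rfl rfl h1 h2 _ _

section

variable {σ : M → P} (hσ : ∀ y, pr (σ y) = y)

/-- The map `q ⊗ g ⊗ p⁻¹ ↦ (σ(t g)⁻¹ q) g (p⁻¹ σ(s g))` defined by a set-theoretic section `σ`;
it is inverse to `g ↦ σ(t g) ⊗ g ⊗ σ(s g)⁻¹`. -/
noncomputable def untwist : Twist X R → G :=
  Quot.lift (fun a => toAux X R σ σ a.1) (fun _ _ h => toAux_rel hσ hσ h)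

theorem untwist_mk {g : G} {q p : P} (hq : q = σ (𝒢.tgt g)) (hp : p = σ (𝒢.src g))
    (h1 : pr q = 𝒢.tgt g) (h2 : pr p = 𝒢.src g) :
    untwist (X := X) (R := R) hσ (mk X R q g p h1 h2) = g := by
  subst hq hp
  change 𝒢.mul (𝒢.mul (X.incl (R.div (σ (𝒢.tgt g)) (σ (𝒢.tgt g)))) g)
    (X.incl (R.div (σ (𝒢.src g)) (σ (𝒢.src g)))) = g
  rw [R.div_self, R.div_self, hσ, hσ, X.isHom_incl.map_unit, X.isHom_incl.map_unit,
    𝒢.unit_mul, 𝒢.mul_unit]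

theorem mk_untwist (w : Twist X R) (h1 : pr (σ (tgt X R w)) = 𝒢.tgt (untwist hσ w))
    (h2 : pr (σ (src X R w)) = 𝒢.src (untwist hσ w)) :
    mk X R (σ (tgt X R w)) (untwist hσ w) (σ (src X R w)) h1 h2 = w := by
  obtain ⟨g, h3, h4, h⟩ := exists_eq_mk w (hσ _) (hσ _)
  rw [hσ] at h3 h4
  have e : untwist hσ w = g := by
    conv_lhs => rw [h]
    exact untwist_mk hσ (by rw [h3]) (by rw [h4]) _ _
  exact (mk_congr rfl e rfl _ _ _ _).trans h.symm

theorem src_untwist (w : Twist X R) : 𝒢.src (untwist hσ w) = src X R w := by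
  induction w using Quot.ind with
  | mk a => exact src_toAux a.2.1 a.2.2 hσ hσ

theorem tgt_untwist (w : Twist X R) : 𝒢.tgt (untwist hσ w) = tgt X R w := by
  induction w using Quot.ind with
  | mk a => exact tgt_toAux a.2.1 a.2.2 hσ hσ

end

theorem mk_right_injective {q p p' : P} {g : G} (hq : pr q = 𝒢.tgt g) (hp : pr p = 𝒢.src g)
    (hp' : pr p' = 𝒢.src g) (h : mk X R q g p hq hp = mk X R q g p' hq hp') : p = p' := by
  have hσ : ∀ y, pr (R.sec (pr q) y) = y := R.pr_sec _
  have e := congrArg (untwist hσ) h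
  set σ := R.sec (pr q)
  change 𝒢.mul (𝒢.mul (X.incl (R.div (σ (𝒢.tgt g)) q)) g) (X.incl (R.div p (σ (𝒢.src g)))) =
    𝒢.mul (𝒢.mul (X.incl (R.div (σ (𝒢.tgt g)) q)) g) (X.incl (R.div p' (σ (𝒢.src g)))) at e
  have c1 := toAux_c3 (X := X) (R := R) (a := (q, g, p)) hq hp hσ hσ
  have c2 := toAux_c3 (X := X) (R := R) (a := (q, g, p')) hq hp' hσ hσ
  have e2 := congrArg (𝒢.mul (𝒢.inv (𝒢.mul (X.incl (R.div (σ (𝒢.tgt g)) q)) g))) e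
  rw [𝒢.inv_mul_cancel_left _ _ c1, 𝒢.inv_mul_cancel_left _ _ c2] at e2
  have e3 := X.isSmoothEmbedding_incl.isEmbedding.injective e2
  have f1 : pr p = pr (σ (𝒢.src g)) := by rw [hσ, hp]
  have f2 : pr p' = pr (σ (𝒢.src g)) := by rw [hσ, hp']
  rw [← R.act_div _ _ f1.symm, ← R.act_div _ _ f2.symm, ← R.div_inv _ _ f1, ← R.div_inv _ _ f2, e3]

/-- By exactness, an arrow of the twisted groupoid with the same end points and the same image in
`E` as `g` can be written `q ⊗ g ⊗ p⁻¹`, with any prescribed `q`. -/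
theorem exists_eq_mk_of_proj_eq (w : Twist X R) {q : P} {g : G} (hq : pr q = 𝒢.tgt g)
    (hs : src X R w = 𝒢.src g) (ht : tgt X R w = 𝒢.tgt g) (h : proj X R w = X.proj g) :
    ∃ (p : P) (hp : pr p = 𝒢.src g), w = mk X R q g p hq hp := by
  obtain ⟨p₀, hp₀⟩ := R.surjective (src X R w)
  obtain ⟨g', h1, h2, rfl⟩ := exists_eq_mk w (hq.trans ht.symm) hp₀
  obtain ⟨l, hl, rfl⟩ := X.exists_eq_mul_incl hs ht h
  have hp : pr (R.act p₀ (𝒦.inv l)) = 𝒢.src g := by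
    rw [R.pr_act _ _ (by rw [hp₀, hs, 𝒦.src_inv, 𝒦.tgt_eq_src, hl]), hp₀, hs]
  exact ⟨_, hp, mk_mul_incl hl _ _ _ _⟩

/-! ### Smoothness of the local trivializations -/

section

variable [IsManifold (𝓡 dG) ∞ G]

theorem contMDiffAt_toArrow {x y : M} {w : Twist X R} (hw : w ∈ (triv X R x y).source) :
    ContMDiffAt (𝓡 dG) (𝓡 dG) ∞ (toArrow X R x y) w := by
  set c := chartAt (EuclideanSpace ℝ (Fin dG)) (toArrow X R x y w)
  set e := (triv X R x y).trans c with he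
  have hem : e ∈ IsManifold.maximalAtlas (𝓡 dG) ∞ (Twist X R) :=
    IsManifold.subset_maximalAtlas ⟨_, ⟨x, y, rfl⟩, c, chart_mem_atlas _ _, rfl⟩
  have hws : w ∈ e.source := by
    rw [he, OpenPartialHomeomorph.trans_source]
    exact ⟨hw, mem_chart_source _ (toArrow X R x y w)⟩
  have h1 : ContMDiffAt (𝓡 dG) (𝓡 dG) ∞ (fun w' => c.symm (e w')) w :=
    (contMDiffAt_symm_of_mem_maximalAtlas (IsManifold.chart_mem_maximalAtlas _)
      (c.map_source (mem_chart_source _ (toArrow X R x y w)))).comp w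
      (contMDiffAt_of_mem_maximalAtlas hem hws)
  refine h1.congr_of_eventuallyEq ?_
  filter_upwards [e.open_source.mem_nhds hws] with w' hw'
  rw [he, OpenPartialHomeomorph.trans_source] at hw'
  exact (c.left_inv hw'.2).symm

theorem contMDiffAt_ofArrow {x y : M} {g : G} (hg : g ∈ (triv X R x y).target) :
    ContMDiffAt (𝓡 dG) (𝓡 dG) ∞ (ofArrow X R x y) g := by
  set c := chartAt (EuclideanSpace ℝ (Fin dG)) g
  set e := (triv X R x y).trans c with he
  have hem : e ∈ IsManifold.maximalAtlas (𝓡 dG) ∞ (Twist X R) :=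
    IsManifold.subset_maximalAtlas ⟨_, ⟨x, y, rfl⟩, c, chart_mem_atlas _ _, rfl⟩
  have hgc : g ∈ c.source := mem_chart_source _ g
  have hgt : c g ∈ e.target := by
    rw [he, OpenPartialHomeomorph.trans_target]
    refine ⟨c.map_source hgc, ?_⟩
    change c.symm (c g) ∈ (triv X R x y).target
    rwa [c.left_inv hgc]
  have h1 : ContMDiffAt (𝓡 dG) (𝓡 dG) ∞ (fun g' => e.symm (c g')) g :=
    (contMDiffAt_symm_of_mem_maximalAtlas hem hgt).comp g
      (contMDiffAt_of_mem_maximalAtlas (IsManifold.chart_mem_maximalAtlas _) hgc)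
  refine h1.congr_of_eventuallyEq ?_
  filter_upwards [c.open_source.mem_nhds hgc] with g' hg'
  change ofArrow X R x y g' = ofArrow X R x y (c.symm (c g'))
  rw [c.left_inv hg']

/-- For a smooth section `σ` of `P`, the bijection `G → P ⊗_K G ⊗_K P⁻¹` it defines is smooth. -/
theorem contMDiff_mk_section {σ : M → P} (hσ : ∀ y, pr (σ y) = y)
    (hs : ContMDiff (𝓡 n) (𝓡 dP) ∞ σ) :
    ContMDiff (𝓡 dG) (𝓡 dG) ∞
      (fun g => mk X R (σ (𝒢.tgt g)) g (σ (𝒢.src g)) (hσ _) (hσ _)) := by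
  intro g₀
  set x := 𝒢.src g₀
  set y := 𝒢.tgt g₀
  have ht := 𝒢.isSubmersion_tgt.contMDiff
  have hsr := 𝒢.isSubmersion_src.contMDiff
  set f : G → G := fun g => toAux X R (R.sec y) (R.sec x) (σ (𝒢.tgt g), g, σ (𝒢.src g))
  have hf : ContMDiffAt (𝓡 dG) (𝓡 dG) ∞ f g₀ := by
    refine contMDiffAt_comp_of_eventually_mem
      (contMDiffOn_toAux (X := X) (R := R) (R.pr_sec y) (R.pr_sec x) (R.contMDiffOn_sec y)
        (R.contMDiffOn_sec x)) (f := fun g => (σ (𝒢.tgt g), g, σ (𝒢.src g)))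
      ((hs.comp ht).contMDiffAt.prodMk (contMDiffAt_id.prodMk (hs.comp hsr).contMDiffAt)) ?_
    filter_upwards [ht.continuous.continuousAt.preimage_mem_nhds
        ((R.isOpen_dom y).mem_nhds (R.mem_dom y)),
      hsr.continuous.continuousAt.preimage_mem_nhds ((R.isOpen_dom x).mem_nhds (R.mem_dom x))]
      with g h1 h2
    exact ⟨hσ _, hσ _, h1, h2⟩
  have hg : f g₀ ∈ (triv X R x y).target := by
    change 𝒢.tgt (toAux X R _ _ _) ∈ R.dom y ∧ 𝒢.src (toAux X R _ _ _) ∈ R.dom x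
    rw [tgt_toAux (hσ _) (hσ _) (R.pr_sec y) (R.pr_sec x),
      src_toAux (hσ _) (hσ _) (R.pr_sec y) (R.pr_sec x)]
    exact ⟨R.mem_dom y, R.mem_dom x⟩
  have h := (contMDiffAt_ofArrow hg).comp g₀ hf
  refine h.congr_of_eventuallyEq (Filter.Eventually.of_forall fun g => ?_)
  exact (ofArrow_toArrow X R x y _).symm

theorem contMDiff_untwist {σ : M → P} (hσ : ∀ y, pr (σ y) = y)
    (hs : ContMDiff (𝓡 n) (𝓡 dP) ∞ σ) :
    ContMDiff (𝓡 dG) (𝓡 dG) ∞ (untwist (X := X) (R := R) hσ) := by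
  intro w₀
  set x := src X R w₀
  set y := tgt X R w₀
  have ht := 𝒢.isSubmersion_tgt.contMDiff
  have hsr := 𝒢.isSubmersion_src.contMDiff
  have hw : w₀ ∈ (triv X R x y).source := ⟨R.mem_dom _, R.mem_dom _⟩
  set g₀ := toArrow X R x y w₀
  have e1 : 𝒢.tgt g₀ = y := tgt_toArrow X R x y w₀
  have e2 : 𝒢.src g₀ = x := src_toArrow X R x y w₀
  set f : G → G := fun g => toAux X R σ σ (R.sec y (𝒢.tgt g), g, R.sec x (𝒢.src g))
  have hy : ContMDiffAt (𝓡 n) (𝓡 dP) ∞ (R.sec y) (𝒢.tgt g₀) := by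
    rw [e1]
    exact (R.contMDiffOn_sec y).contMDiffAt ((R.isOpen_dom y).mem_nhds (R.mem_dom y))
  have hx : ContMDiffAt (𝓡 n) (𝓡 dP) ∞ (R.sec x) (𝒢.src g₀) := by
    rw [e2]
    exact (R.contMDiffOn_sec x).contMDiffAt ((R.isOpen_dom x).mem_nhds (R.mem_dom x))
  have hf : ContMDiffAt (𝓡 dG) (𝓡 dG) ∞ f g₀ := by
    refine contMDiffAt_comp_of_eventually_mem
      (contMDiffOn_toAux (X := X) (R := R) hσ hσ (V := univ) (U := univ) hs.contMDiffOn
        hs.contMDiffOn) (f := fun g => (R.sec y (𝒢.tgt g), g, R.sec x (𝒢.src g)))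
      ((hy.comp g₀ ht.contMDiffAt).prodMk (contMDiffAt_id.prodMk (hx.comp g₀ hsr.contMDiffAt)))
      (Filter.Eventually.of_forall fun g => ?_)
    exact ⟨R.pr_sec _ _, R.pr_sec _ _, trivial, trivial⟩
  have h := ContMDiffAt.comp w₀ hf (contMDiffAt_toArrow hw)
  refine h.congr_of_eventuallyEq (Filter.Eventually.of_forall fun w => ?_)
  exact congrArg (untwist hσ) (ofArrow_toArrow X R x y w).symm

end

end Twist

end

section

variable {n dK dL dG dE dP q : ℕ} {M K L G E P T : Type*}
  [TopologicalSpace M] [ChartedSpace (EuclideanSpace ℝ (Fin n)) M]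
  [TopologicalSpace K] [ChartedSpace (EuclideanSpace ℝ (Fin dK)) K]
  [TopologicalSpace L] [ChartedSpace (EuclideanSpace ℝ (Fin dL)) L]
  [TopologicalSpace G] [ChartedSpace (EuclideanSpace ℝ (Fin dG)) G]
  [TopologicalSpace E] [ChartedSpace (EuclideanSpace ℝ (Fin dE)) E]
  [TopologicalSpace P] [ChartedSpace (EuclideanSpace ℝ (Fin dP)) P]
  [TopologicalSpace T] [ChartedSpace (EuclideanSpace ℝ (Fin q)) T]
  {𝒦 : LieGroupBundle n dK M K} {ℒ : LieGroupBundle n dL M L}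
  {𝒢 : LieGroupoid n dG M G} {ℰ : LieGroupoid n dE M E}

/-! ### The inclusion `j_P` -/

namespace Twist

variable (X : Extension 𝒦 𝒢 ℰ) (B : Bitorsor dP ℒ 𝒦 P)

/-- The arrow `j_P(l) = l p ⊗ 1_x ⊗ p⁻¹` does not depend on `p`. -/
theorem incl_eq_mk (l : L) {p : P} (hp : B.pr p = ℒ.src l)
    (h1 : B.pr (B.left.act l p) = 𝒢.tgt (𝒢.unit (ℒ.src l)))
    (h2 : B.pr p = 𝒢.src (𝒢.unit (ℒ.src l))) :
    incl X B l = mk X B.right (B.left.act l p) (𝒢.unit (ℒ.src l)) p h1 h2 := by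
  set s := B.right.sec (ℒ.src l) (ℒ.src l)
  have hs' : B.pr s = ℒ.src l := B.right.pr_sec _ _
  have e : B.pr s = B.pr p := hs'.trans hp.symm
  obtain ⟨k, hk, rfl⟩ : ∃ k, 𝒦.src k = ℒ.src l ∧ B.right.act s k = p :=
    ⟨B.right.div s p, (B.right.src_div _ _ e).trans hs', B.right.act_div _ _ e⟩
  have hc := B.comm l s k hs'.symm (hs'.trans hk.symm)
  have hls := B.left.pr_act l s hs'.symm
  symm
  rw [mk_congr hc rfl rfl h1 h2 (hc ▸ h1) h2]
  exact mk_unit_act hk _ _ _ _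

variable {X B}

theorem incl_injective {l l' : L} (hs : ℒ.src l = ℒ.src l') (h : incl X B l = incl X B l') :
    l = l' := by
  obtain ⟨p, hp⟩ := B.left.surjective (ℒ.src l)
  have hp' := hp.trans hs
  have h1 : B.pr (B.left.act l p) = ℒ.src l := (B.left.pr_act _ _ hp.symm).trans hp
  have h1' : B.pr (B.left.act l' p) = ℒ.src l := (B.left.pr_act _ _ hp'.symm).trans hp
  have t := 𝒢.tgt_unit (ℒ.src l)
  have s := 𝒢.src_unit (ℒ.src l)
  rw [incl_eq_mk X B l hp (h1.trans t.symm) (hp.trans s.symm),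
    incl_eq_mk X B l' hp' (h1'.trans (by rw [hs, 𝒢.tgt_unit])) (hp'.trans (𝒢.src_unit _).symm),
    mk_congr (g' := 𝒢.unit (ℒ.src l)) rfl (by rw [hs]) rfl _ _ (h1'.trans t.symm)
      (hp.trans s.symm)] at h
  -- Inversion exchanges the two outer factors.
  have e : B.left.act l p = B.left.act l' p :=
    mk_right_injective (X := X) (R := B.right) (q := p) (g := 𝒢.inv (𝒢.unit (ℒ.src l)))
      (by rw [𝒢.tgt_inv, hp, s]) (by rw [𝒢.src_inv, h1, t]) (by rw [𝒢.src_inv, h1', t])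
      (congrArg (inv X B.right) h)
  rw [← B.left.act_div l p hp.symm, e, B.left.act_div l' p hp'.symm]

end Twist

/-! ### The isomorphism defined by a global section -/

namespace SectionOver

variable {B : Bitorsor dP ℒ 𝒦 P} (X : Extension 𝒦 𝒢 ℰ) (β : GlobalSection B)

theorem pr_toFun (x : M) : B.pr (β.toFun x) = x := β.pr_apply x

theorem conjMap_act (k : K) :
    B.left.act (conjMap β k) (β.toFun (𝒦.src k)) = B.right.act (β.toFun (𝒦.src k)) k :=
  B.left.div_act _ _ (B.right.pr_act _ _ (β.pr_toFun _))

theorem src_conjMap (k : K) : ℒ.src (conjMap β k) = 𝒦.src k :=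
  (B.left.src_div _ _ (B.right.pr_act _ _ (β.pr_toFun _))).trans (β.pr_toFun _)

theorem conjMap_eq {k : K} {l : L} (hl : ℒ.src l = 𝒦.src k)
    (h : B.left.act l (β.toFun (𝒦.src k)) = B.right.act (β.toFun (𝒦.src k)) k) :
    conjMap β k = l := by
  change B.left.div (B.right.act (β.toFun (𝒦.src k)) k) (β.toFun (𝒦.src k)) = l
  rw [← h, B.left.act_div _ _ (hl.trans (β.pr_toFun _).symm)]

theorem isHom_conjMap : 𝒦.toGroupoidData.IsHom ℒ.toGroupoidData (conjMap β) := by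
  have hmul : ∀ k l, 𝒦.src k = 𝒦.tgt l →
      conjMap β (𝒦.mul k l) = ℒ.mul (conjMap β k) (conjMap β l) := by
    intro k l e
    have e' : 𝒦.src k = 𝒦.src l := e.trans (𝒦.tgt_eq_src l)
    have c : ℒ.src (conjMap β k) = ℒ.tgt (conjMap β l) := by
      rw [ℒ.tgt_eq_src, src_conjMap, src_conjMap, e']
    have s : 𝒦.src (𝒦.mul k l) = 𝒦.src l := 𝒦.src_mul _ _ e
    have hp := β.pr_toFun (𝒦.src l)
    refine β.conjMap_eq (by rw [ℒ.src_mul _ _ c, src_conjMap, s]) ?_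
    rw [s, B.left.mul_act _ _ _ (by rw [src_conjMap, hp, e']) (by rw [src_conjMap, hp]),
      conjMap_act, B.comm _ _ _ (by rw [src_conjMap, hp, e']) hp, ← e', conjMap_act]
    have hp' := β.pr_toFun (𝒦.src k)
    exact B.right.act_mul _ _ _ hp' (hp'.trans e')
  have hunit : ∀ x, conjMap β (𝒦.unit x) = ℒ.unit x := by
    intro x
    refine β.conjMap_eq (by rw [ℒ.src_unit, 𝒦.src_unit]) ?_
    have h1 := B.left.unit_act (β.toFun x)
    have h2 := B.right.act_unit (β.toFun x)
    rw [β.pr_toFun] at h1 h2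
    rw [𝒦.src_unit, h1, h2]
  refine ⟨β.src_conjMap, fun k => ?_, hmul, fun k => ?_, hunit⟩
  · exact (ℒ.tgt_eq_src _).trans ((β.src_conjMap k).trans (𝒦.tgt_eq_src k).symm)
  · symm
    apply ℒ.inv_eq_of_mul
    · rw [src_conjMap, ℒ.tgt_eq_src, src_conjMap, 𝒦.src_inv, 𝒦.tgt_eq_src]
    · rw [← hmul _ _ (𝒦.tgt_inv k).symm, 𝒦.mul_inv, hunit, ℒ.tgt_eq_src, src_conjMap,
        𝒦.tgt_eq_src]

theorem isHom_hatMap : 𝒢.toGroupoidData.IsHom (Twist.groupoidData X B.right) (hatMap X β) where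
  map_src _ := rfl
  map_tgt _ := rfl
  map_mul g h e := by
    have h1 : hatMap X β g = Twist.mk X B.right (β.toFun (𝒢.tgt g)) g (β.toFun (𝒢.tgt h))
        (β.pr_toFun _) ((β.pr_toFun _).trans e.symm) :=
      Twist.mk_congr rfl rfl (congrArg β.toFun e) (β.pr_toFun _) (β.pr_toFun _) _ _
    refine Eq.trans ?_ (Eq.trans (Twist.mul_mk_mk e _ _ (β.pr_toFun _) (β.pr_toFun _)).symm
      (congrArg (fun w => Twist.mul X B.right w (hatMap X β h)) h1.symm))
    exact Twist.mk_congr (congrArg β.toFun (𝒢.tgt_mul _ _ e)) rfl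
      (congrArg β.toFun (𝒢.src_mul _ _ e)) (β.pr_toFun _) (β.pr_toFun _) _ _
  map_inv g := Twist.mk_congr (congrArg β.toFun (𝒢.tgt_inv g)) rfl
    (congrArg β.toFun (𝒢.src_inv g)) (β.pr_toFun _) (β.pr_toFun _)
    ((β.pr_toFun _).trans (𝒢.tgt_inv g).symm) ((β.pr_toFun _).trans (𝒢.src_inv g).symm)
  map_unit x := by
    set s := B.right.sec x x
    have hs' : B.pr s = x := B.right.pr_sec _ _
    have e : B.pr s = B.pr (β.toFun x) := hs'.trans (β.pr_toFun x).symm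
    have hd := B.right.act_div _ _ e
    have t := 𝒢.tgt_unit x
    have s' := 𝒢.src_unit x
    have hp := β.pr_toFun x
    refine Eq.trans (Twist.mk_congr (q' := B.right.act s (B.right.div s (β.toFun x)))
      (p' := B.right.act s (B.right.div s (β.toFun x))) ?_ rfl ?_ (β.pr_toFun _)
      (β.pr_toFun _) (by rw [hd, hp, t]) (by rw [hd, hp, s']))
      (Twist.mk_unit_act ((B.right.src_div _ _ e).trans hs') _ _ (hs'.trans t.symm)
        (hs'.trans s'.symm))
    · exact (congrArg β.toFun t).trans hd.symm
    · exact (congrArg β.toFun s').trans hd.symm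

theorem hatMap_incl (k : K) : hatMap X β (X.incl k) = Twist.incl X B (conjMap β k) := by
  have hs := β.src_conjMap k
  have hp := β.pr_toFun (𝒦.src k)
  have ha := B.right.pr_act _ _ hp
  have t := 𝒢.tgt_unit (𝒦.src k)
  have s := 𝒢.src_unit (𝒦.src k)
  have e : 𝒢.mul (X.incl k) (𝒢.unit (𝒦.src k)) = X.incl k := by
    rw [← Twist.src_incl X, 𝒢.mul_unit]
  have tk := Twist.tgt_incl X k
  have sk := Twist.src_incl X k
  rw [Twist.incl_eq_mk X B (conjMap β k) (hp.trans hs.symm)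
      (by rw [conjMap_act, ha, hs, hp, t]) (by rw [hs, hp, s]),
    Twist.mk_congr (β.conjMap_act k) (congrArg 𝒢.unit hs) rfl _ _ (by rw [ha, hp, t])
      (by rw [hp, s]),
    Twist.mk_act_left t.symm _ _ (by rw [e, tk, hp]) (by rw [e, sk, hp])]
  exact Twist.mk_congr (congrArg β.toFun tk) e.symm (congrArg β.toFun sk) (β.pr_toFun _)
    (β.pr_toFun _) _ _

/-- A section `β` of `P` over `M` defines an isomorphism of extensions. -/
theorem isExtIso [IsManifold (𝓡 dG) ∞ G] :
    IsExtIso (dK := dK) (dL := dL) (dG := dG) (dH := dG) X.toExtDiagram (X.twist B)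
      (conjMap β) (hatMap X β) where
  diffeo_left := by
    have hK := 𝒦.isSubmersion_src.contMDiff
    have hL := ℒ.isSubmersion_src.contMDiff
    have hβ := β.contMDiff
    refine ⟨⟨⟨conjMap β, fun l => B.right.div (β.toFun (ℒ.src l))
      (B.left.act l (β.toFun (ℒ.src l))), fun k => ?_, fun l => ?_⟩, fun k => ?_, fun l => ?_⟩, rfl⟩
    · change B.right.div (β.toFun (ℒ.src (conjMap β k)))
        (B.left.act (conjMap β k) (β.toFun (ℒ.src (conjMap β k)))) = k
      rw [src_conjMap, conjMap_act, B.right.div_act _ _ (β.pr_toFun _)]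
    · have hp := β.pr_toFun (ℒ.src l)
      have e : B.pr (β.toFun (ℒ.src l)) = B.pr (B.left.act l (β.toFun (ℒ.src l))) :=
        (B.left.pr_act _ _ hp.symm).symm
      have s : 𝒦.src (B.right.div (β.toFun (ℒ.src l)) (B.left.act l (β.toFun (ℒ.src l)))) =
          ℒ.src l := (B.right.src_div _ _ e).trans hp
      refine β.conjMap_eq s.symm ?_
      rw [s, B.right.act_div _ _ e]
    · have h1 : ContMDiffAt (𝓡 dK) (𝓡 dP) ∞ (fun k => β.toFun (𝒦.src k)) k :=
        (hβ.comp hK).contMDiffAt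
      have h2 : ContMDiffAt (𝓡 dK) (𝓡 dP) ∞
          (fun k => B.right.act (β.toFun (𝒦.src k)) k) k :=
        contMDiffAt_comp_of_eventually_mem B.right.contMDiffOn_act (h1.prodMk contMDiffAt_id)
          (Filter.Eventually.of_forall fun k => β.pr_toFun _)
      exact contMDiffAt_comp_of_eventually_mem B.left.contMDiffOn_div (h2.prodMk h1)
        (Filter.Eventually.of_forall fun k => B.right.pr_act _ _ (β.pr_toFun _))
    · have h1 : ContMDiffAt (𝓡 dL) (𝓡 dP) ∞ (fun l => β.toFun (ℒ.src l)) l :=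
        (hβ.comp hL).contMDiffAt
      have h2 : ContMDiffAt (𝓡 dL) (𝓡 dP) ∞
          (fun l => B.left.act l (β.toFun (ℒ.src l))) l :=
        contMDiffAt_comp_of_eventually_mem B.left.contMDiffOn_act (contMDiffAt_id.prodMk h1)
          (Filter.Eventually.of_forall fun l => (β.pr_toFun _).symm)
      exact contMDiffAt_comp_of_eventually_mem B.right.contMDiffOn_div (h1.prodMk h2)
        (Filter.Eventually.of_forall fun l => (B.left.pr_act _ _ (β.pr_toFun _).symm).symm)
  diffeo := by
    refine ⟨⟨⟨hatMap X β, Twist.untwist β.pr_toFun, fun g => ?_, fun w => ?_⟩,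
      Twist.contMDiff_mk_section β.pr_toFun β.contMDiff,
      Twist.contMDiff_untwist β.pr_toFun β.contMDiff⟩, rfl⟩
    · exact Twist.untwist_mk _ rfl rfl (β.pr_toFun _) (β.pr_toFun _)
    · have s := Twist.src_untwist (X := X) β.pr_toFun w
      have t := Twist.tgt_untwist (X := X) β.pr_toFun w
      have s' := (β.pr_toFun (Twist.src X B.right w)).trans s.symm
      have t' := (β.pr_toFun (Twist.tgt X B.right w)).trans t.symm
      exact (Twist.mk_congr (congrArg β.toFun t) rfl (congrArg β.toFun s) (β.pr_toFun _)
        (β.pr_toFun _) t' s').trans (Twist.mk_untwist β.pr_toFun w t' s')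
  isHom_left := β.isHom_conjMap
  isHom := β.isHom_hatMap X
  comm_incl := β.hatMap_incl X
  comm_proj _ := rfl

variable {X β}

/-- As `j_P` is injective, the condition `u j = j_P v` determines `v` from `u`. -/
theorem eq_conjMap_of_isExtIso {v : K → L} {u : G → Twist X B.right}
    (h : IsExtIso (dK := dK) (dL := dL) (dG := dG) (dH := dG) X.toExtDiagram (X.twist B) v u)
    (hu : u = hatMap X β) : v = conjMap β := by
  funext k
  refine Twist.incl_injective (X := X) (B := B)
    ((h.isHom_left.map_src k).trans (β.src_conjMap k).symm) ?_
  rw [← hatMap_incl, ← hu]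
  exact (h.comm_incl k).symm

/-! ### The section defined by an isomorphism -/

variable {ι : T → M} {α : SectionOver q B ι}

/-- The value of `β̂` at an arrow ending in `T` involves `β` only at the source: if `h : x → y` with `y ∈ T`, then
`β̂(h) = α(y) ⊗ h ⊗ β(x)⁻¹`. -/
theorem hatMap_eq_mk (hβ : Extends β α) {h : G} {a : T} (ht : 𝒢.tgt h = ι a) :
    hatMap X β h = Twist.mk X B.right (α.toFun a) h (β.toFun (𝒢.src h))
      ((α.pr_apply a).trans ht.symm) (β.pr_toFun _) :=
  Twist.mk_congr ((congrArg β.toFun ht).trans (hβ a)) rfl rfl (β.pr_toFun _) (β.pr_toFun _) _ _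

end SectionOver

open SectionOver

theorem IsCompleteTransversal.exists_arrow {𝒢 : LieGroupoid n dG M G} {ι : T → M}
    (hι : IsCompleteTransversal q 𝒢 ι) (x : M) :
    ∃ (a : T) (h : G), 𝒢.src h = x ∧ 𝒢.tgt h = ι a := by
  obtain ⟨a, h, hh, ht⟩ := hι.meets_leaf x
  exact ⟨a, h, connectedComponentIn_subset {g : G | 𝒢.src g = x} _ hh, ht⟩

/-- An isomorphism of extensions which is `α̂` over a complete transversal has the form
`u(k) = α(y) ⊗ k ⊗ b(x)⁻¹` on the arrows `k : x → y` ending in `T`, with `b(x)` depending only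
on `x`. -/
theorem IsExtIso.exists_setSection {X : Extension 𝒦 𝒢 ℰ} {ι : T → M}
    (hι : IsCompleteTransversal q 𝒢 ι) {B : Bitorsor dP ℒ 𝒦 P} {α : SectionOver q B ι} {v : K → L}
    {u : G → Twist X B.right}
    (h : IsExtIso (dK := dK) (dL := dL) (dG := dG) (dH := dG) X.toExtDiagram (X.twist B) v u)
    (hα : RestrictsToHat X α u) :
    ∃ b : M → P, ∃ hb : ∀ x, B.pr (b x) = x,
    ∀ (k : G) (a : T) (ht : 𝒢.tgt k = ι a), u k = Twist.mk X B.right (α.toFun a) k (b (𝒢.src k))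
      ((α.pr_apply a).trans ht.symm) (hb _) := by
  have key : ∀ x, ∃ p, B.pr p = x ∧ ∀ (k : G) (a : T) (hs : B.pr p = 𝒢.src k)
      (ht : 𝒢.tgt k = ι a), 𝒢.src k = x → u k = Twist.mk X B.right (α.toFun a) k p
      ((α.pr_apply a).trans ht.symm) hs := by
    intro x
    obtain ⟨a₀, k₀, hs₀, ht₀⟩ := hι.exists_arrow x
    obtain ⟨p, hp, e⟩ := Twist.exists_eq_mk_of_proj_eq (u k₀)
      ((α.pr_apply a₀).trans ht₀.symm) (h.isHom.map_src k₀) (h.isHom.map_tgt k₀) (h.comm_proj k₀)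
    refine ⟨p, hp.trans hs₀, fun k a hs ht hx => ?_⟩
    -- `k = g k₀` where `g = k k₀⁻¹` is an arrow of `G_T`.
    have c : 𝒢.src k = 𝒢.tgt (𝒢.inv k₀) := by rw [𝒢.tgt_inv, hs₀, hx]
    set g := 𝒢.mul k (𝒢.inv k₀) with hg
    have sg : 𝒢.src g = ι a₀ := by rw [hg, 𝒢.src_mul _ _ c, 𝒢.src_inv, ht₀]
    have tg : 𝒢.tgt g = ι a := by rw [hg, 𝒢.tgt_mul _ _ c, ht]
    have c' : 𝒢.src g = 𝒢.tgt k₀ := sg.trans ht₀.symm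
    have hk : 𝒢.mul g k₀ = k := 𝒢.inv_mul_cancel_right _ _ (hx.trans hs₀.symm)
    have e1 : u k = Twist.mul X B.right (u g) (u k₀) := by
      conv_lhs => rw [← hk]
      exact h.isHom.map_mul g k₀ c'
    rw [e1, hα a₀ a g sg tg, e]
    exact (Twist.mul_mk_mk c' _ _ _ _).trans (Twist.mk_congr rfl hk rfl _ _ _ _)
  choose b hb hbk using key
  exact ⟨b, hb, fun k a ht => hbk _ k a (hb _) ht rfl⟩

/-- The section `b` of `IsExtIso.exists_setSection` is smooth: near `x₀`, it can be computed from
the values of `u` on a smooth family of arrows from points near `x₀` to `T`. -/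
theorem contMDiff_of_eq_mk [IsManifold (𝓡 n) ∞ M] [IsManifold (𝓡 dG) ∞ G] [IsManifold (𝓡 q) ∞ T]
    [IsManifold (𝓡 dK) ∞ K] {X : Extension 𝒦 𝒢 ℰ} {ι : T → M} (hι : IsCompleteTransversal q 𝒢 ι)
    {B : Bitorsor dP ℒ 𝒦 P} {α : SectionOver q B ι} {u : G → Twist X B.right}
    (hu : ContMDiff (𝓡 dG) (𝓡 dG) ∞ u) {b : M → P} (hb : ∀ x, B.pr (b x) = x)
    (hub : ∀ (k : G) (a : T) (ht : 𝒢.tgt k = ι a), u k = Twist.mk X B.right (α.toFun a) k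
      (b (𝒢.src k)) ((α.pr_apply a).trans ht.symm) (hb _)) :
    ContMDiff (𝓡 n) (𝓡 dP) ∞ b := by
  intro x₀
  have ht := 𝒢.isSubmersion_tgt.contMDiff
  obtain ⟨a₀, k₀, rfl, ht₀⟩ := hι.exists_arrow x₀
  obtain ⟨σ, hσ, hσ0, hσs⟩ := exists_section_through (𝒢.isSubmersion_src.isSubmersionAt k₀)
  obtain ⟨A, Γ, hA, hΓ, hAΓ⟩ := hι.exists_smooth_arrows a₀
  set x₀ := 𝒢.src k₀
  -- The arrow `κ x : x → ι (a x)` is `σ x` followed by the inverse of an arrow from `T` to its end.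
  have htσ : ContMDiffAt (𝓡 n) (𝓡 n) ∞ (fun x => 𝒢.tgt (σ x)) x₀ := ht.contMDiffAt.comp x₀ hσ
  have htσ0 : 𝒢.tgt (σ x₀) = ι a₀ := by rw [hσ0, ht₀]
  let a : M → T := fun x => A (𝒢.tgt (σ x))
  let γ : M → G := fun x => 𝒢.inv (Γ (𝒢.tgt (σ x)))
  let κ : M → G := fun x => 𝒢.mul (γ x) (σ x)
  have ha : ContMDiffAt (𝓡 n) (𝓡 q) ∞ a x₀ :=
    ContMDiffAt.comp x₀ (g := A) (by rw [htσ0]; exact hA) htσ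
  have hγ : ContMDiffAt (𝓡 n) (𝓡 dG) ∞ γ x₀ :=
    𝒢.contMDiff_inv.contMDiffAt.comp x₀
      (ContMDiffAt.comp x₀ (g := Γ) (by rw [htσ0]; exact hΓ) htσ)
  have hAΓ' : ∀ᶠ x in 𝓝 x₀, 𝒢.tgt (Γ (𝒢.tgt (σ x))) = 𝒢.tgt (σ x) ∧
      𝒢.src (Γ (𝒢.tgt (σ x))) = ι (a x) := by
    refine htσ.continuousAt.eventually (p := fun y => 𝒢.tgt (Γ y) = y ∧ 𝒢.src (Γ y) = ι (A y)) ?_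
    change ∀ᶠ y in 𝓝 (𝒢.tgt (σ x₀)), _
    rw [htσ0]
    exact hAΓ
  have hc : ∀ᶠ x in 𝓝 x₀, 𝒢.src (γ x) = 𝒢.tgt (σ x) := by
    filter_upwards [hAΓ'] with x hx
    exact (𝒢.src_inv _).trans hx.1
  have hκ : ContMDiffAt (𝓡 n) (𝓡 dG) ∞ κ x₀ :=
    contMDiffAt_comp_of_eventually_mem 𝒢.contMDiffOn_mul (hγ.prodMk hσ) hc
  have hκs : ∀ᶠ x in 𝓝 x₀, 𝒢.src (κ x) = x := by
    filter_upwards [hc, hσs] with x h1 h2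
    exact (𝒢.src_mul _ _ h1).trans h2
  have hκt : ∀ᶠ x in 𝓝 x₀, 𝒢.tgt (κ x) = ι (a x) := by
    filter_upwards [hc, hAΓ'] with x h1 h2
    exact (𝒢.tgt_mul _ _ h1).trans ((𝒢.tgt_inv _).trans h2.2)
  set y₀ := 𝒢.tgt (κ x₀)
  let R := B.right
  have hsec : ContMDiffAt (𝓡 n) (𝓡 dP) ∞ (R.sec x₀) x₀ :=
    (R.contMDiffOn_sec x₀).contMDiffAt ((R.isOpen_dom x₀).mem_nhds (R.mem_dom x₀))
  have hsec' : ContMDiffAt (𝓡 n) (𝓡 dP) ∞ (fun x => R.sec y₀ (𝒢.tgt (κ x))) x₀ :=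
    ContMDiffAt.comp x₀ ((R.contMDiffOn_sec y₀).contMDiffAt
      ((R.isOpen_dom y₀).mem_nhds (R.mem_dom y₀))) (ht.contMDiffAt.comp x₀ hκ)
  -- In the trivialization at `u (κ x₀)`, the arrow `u (κ x)` is `m x` times an element of `K`
  -- which determines `b x`.
  have hw : ContMDiffAt (𝓡 n) (𝓡 dG) ∞ (fun x => Twist.toArrow X R x₀ y₀ (u (κ x))) x₀ := by
    refine ContMDiffAt.comp x₀ (Twist.contMDiffAt_toArrow ?_) (hu.contMDiffAt.comp x₀ hκ)
    change Twist.tgt X R (u (κ x₀)) ∈ R.dom y₀ ∧ Twist.src X R (u (κ x₀)) ∈ R.dom x₀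
    have e := hub (κ x₀) (a x₀) hκt.self_of_nhds
    rw [e]
    change 𝒢.tgt (κ x₀) ∈ R.dom y₀ ∧ 𝒢.src (κ x₀) ∈ R.dom x₀
    rw [hκs.self_of_nhds]
    exact ⟨R.mem_dom _, R.mem_dom _⟩
  let m : M → G := fun x => 𝒢.mul (X.incl (R.div (R.sec y₀ (𝒢.tgt (κ x))) (α.toFun (a x)))) (κ x)
  have hdiv : ∀ᶠ x in 𝓝 x₀, B.pr (R.sec y₀ (𝒢.tgt (κ x))) = B.pr (α.toFun (a x)) := by
    filter_upwards [hκt] with x hx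
    rw [R.pr_sec, α.pr_apply, hx]
  have hmc : ∀ᶠ x in 𝓝 x₀,
      𝒢.src (X.incl (R.div (R.sec y₀ (𝒢.tgt (κ x))) (α.toFun (a x)))) = 𝒢.tgt (κ x) := by
    filter_upwards [hdiv] with x hx
    rw [Twist.src_incl, R.src_div _ _ hx, R.pr_sec]
  have hm : ContMDiffAt (𝓡 n) (𝓡 dG) ∞ m x₀ := by
    refine contMDiffAt_comp_of_eventually_mem 𝒢.contMDiffOn_mul (ContMDiffAt.prodMk ?_ hκ) hmc
    refine X.isSmoothEmbedding_incl.contMDiff.contMDiffAt.comp x₀ ?_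
    exact contMDiffAt_comp_of_eventually_mem R.contMDiffOn_div
      (hsec'.prodMk (α.contMDiff.contMDiffAt.comp x₀ ha)) hdiv
  let D : M → K := fun x => R.div (b x) (R.sec x₀ x)
  have hD0 : ∀ x, B.pr (b x) = B.pr (R.sec x₀ x) := fun x => (hb x).trans (R.pr_sec _ _).symm
  have hwe : ∀ᶠ x in 𝓝 x₀, 𝒢.src (m x) = 𝒢.tgt (X.incl (D x)) ∧
      Twist.toArrow X R x₀ y₀ (u (κ x)) = 𝒢.mul (m x) (X.incl (D x)) := by
    filter_upwards [hκs, hκt, hmc] with x h1 h2 h3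
    refine ⟨?_, ?_⟩
    · rw [𝒢.src_mul _ _ h3, h1, Twist.tgt_incl, R.src_div _ _ (hD0 x), hb]
    · rw [hub (κ x) (a x) h2]
      change 𝒢.mul (m x) (X.incl (R.div (b (𝒢.src (κ x))) (R.sec x₀ (𝒢.src (κ x))))) = _
      rw [h1]
  have hjD : ContMDiffAt (𝓡 n) (𝓡 dG) ∞ (X.incl ∘ D) x₀ := by
    have h1 : ContMDiffAt (𝓡 n) (𝓡 dG) ∞
        (fun x => 𝒢.mul (𝒢.inv (m x)) (Twist.toArrow X R x₀ y₀ (u (κ x)))) x₀ := by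
      refine contMDiffAt_comp_of_eventually_mem 𝒢.contMDiffOn_mul
        (ContMDiffAt.prodMk (𝒢.contMDiff_inv.contMDiffAt.comp x₀ hm) hw) ?_
      filter_upwards [hwe] with x hx
      change 𝒢.src (𝒢.inv (m x)) = 𝒢.tgt (Twist.toArrow X R x₀ y₀ (u (κ x)))
      rw [hx.2, 𝒢.src_inv, 𝒢.tgt_mul _ _ hx.1]
    refine h1.congr_of_eventuallyEq ?_
    filter_upwards [hwe] with x hx
    rw [hx.2, 𝒢.inv_mul_cancel_left _ _ hx.1]
    rfl
  -- As `K` is embedded in `G`, smoothness into `G` suffices.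
  have hD : ContMDiffAt (𝓡 n) (𝓡 dK) ∞ D x₀ :=
    (ContMDiffAt.iff_comp_isImmersionAt
      (X.isSmoothEmbedding_incl.isImmersion.isImmersionAt (D x₀))).2
      ⟨X.isSmoothEmbedding_incl.isEmbedding.continuousAt_iff.2 hjD.continuousAt, hjD⟩
  have h1 : ContMDiffAt (𝓡 n) (𝓡 dP) ∞ (fun x => R.act (R.sec x₀ x) (𝒦.inv (D x))) x₀ := by
    refine contMDiffAt_comp_of_eventually_mem R.contMDiffOn_act
      (hsec.prodMk (𝒦.contMDiff_inv.contMDiffAt.comp x₀ hD)) (Filter.Eventually.of_forall fun x => ?_)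
    change B.pr (R.sec x₀ x) = 𝒦.src (𝒦.inv (D x))
    rw [R.div_inv _ _ (hD0 x), R.src_div _ _ (hD0 x).symm]
  refine h1.congr_of_eventuallyEq (Filter.Eventually.of_forall fun x => ?_)
  change b x = R.act (R.sec x₀ x) (𝒦.inv (R.div (b x) (R.sec x₀ x)))
  rw [R.div_inv _ _ (hD0 x), R.act_div _ _ (hD0 x).symm]

/-- An isomorphism of extensions which is `α̂` over a complete transversal comes from a smooth
section of `P` over `M` which extends `α`. -/
theorem IsExtIso.exists_globalSection [IsManifold (𝓡 n) ∞ M] [IsManifold (𝓡 dG) ∞ G]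
    [IsManifold (𝓡 q) ∞ T] [IsManifold (𝓡 dK) ∞ K] {X : Extension 𝒦 𝒢 ℰ} {ι : T → M}
    (hι : IsCompleteTransversal q 𝒢 ι) {B : Bitorsor dP ℒ 𝒦 P} {α : SectionOver q B ι} {v : K → L}
    {u : G → Twist X B.right}
    (h : IsExtIso (dK := dK) (dL := dL) (dG := dG) (dH := dG) X.toExtDiagram (X.twist B) v u)
    (hα : RestrictsToHat X α u) : ∃ β : GlobalSection B, Extends β α ∧ u = hatMap X β := by
  obtain ⟨b, hb, hub⟩ := h.exists_setSection hι hα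
  obtain ⟨e, he⟩ := h.diffeo
  refine ⟨⟨b, contMDiff_of_eq_mk hι (he ▸ e.contMDiff) hb hub, hb⟩, fun a => ?_, ?_⟩
  · -- Compare the two expressions for `u` at the unit arrow of `a ∈ T`.
    have t := 𝒢.tgt_unit (ι a)
    have s := 𝒢.src_unit (ι a)
    have e1 := (hub (𝒢.unit (ι a)) a t).symm.trans (hα a a _ s t)
    exact (congrArg b s).symm.trans (Twist.mk_right_injective _ _ _ e1)
  · funext g
    obtain ⟨a, k, hs, ht⟩ := hι.exists_arrow (𝒢.tgt g)
    obtain ⟨p, hp, e1⟩ := Twist.exists_eq_mk_of_proj_eq (R := B.right) (u g) (hb (𝒢.tgt g))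
      (h.isHom.map_src g) (h.isHom.map_tgt g) (h.comm_proj g)
    have tkg : 𝒢.tgt (𝒢.mul k g) = ι a := (𝒢.tgt_mul _ _ hs).trans ht
    have skg := 𝒢.src_mul _ _ hs
    -- Both sides are computed from `u (k g) = u k u g`, where `k` ends in `T`.
    have e2 : u (𝒢.mul k g) = Twist.mul X B.right (u k) (u g) := h.isHom.map_mul k g hs
    have e3 : u k = Twist.mk X B.right (α.toFun a) k (b (𝒢.tgt g))
        ((α.pr_apply a).trans ht.symm) ((hb _).trans hs.symm) :=
      (hub k a ht).trans (Twist.mk_congr rfl rfl (congrArg b hs) _ _ _ _)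
    rw [hub _ a tkg, e3, e1, Twist.mul_mk_mk hs] at e2
    have e4 : b (𝒢.src g) = p := (congrArg b skg).symm.trans (Twist.mk_right_injective _ _ _ e2)
    exact e1.trans (Twist.mk_congr rfl rfl e4.symm _ _ (hb _) (hb _))

end

end LieExt

open LieExt LieExt.SectionOver in
theorem proposition4p5 {n dK dG dE q : ℕ} {M K G E T : Type*}
    [TopologicalSpace M] [ChartedSpace (EuclideanSpace ℝ (Fin n)) M]
    [IsManifold (𝓡 n) ∞ M] [T2Space M]
    [TopologicalSpace K] [ChartedSpace (EuclideanSpace ℝ (Fin dK)) K] [IsManifold (𝓡 dK) ∞ K]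
    [TopologicalSpace G] [ChartedSpace (EuclideanSpace ℝ (Fin dG)) G] [IsManifold (𝓡 dG) ∞ G]
    [TopologicalSpace E] [ChartedSpace (EuclideanSpace ℝ (Fin dE)) E] [IsManifold (𝓡 dE) ∞ E]
    [TopologicalSpace T] [ChartedSpace (EuclideanSpace ℝ (Fin q)) T] [IsManifold (𝓡 q) ∞ T]
    {𝒦 : LieGroupBundle n dK M K} {𝒢 : LieGroupoid n dG M G} {ℰ : LieGroupoid n dE M E}
    (X : Extension 𝒦 𝒢 ℰ) (ι : T → M) (hι : IsCompleteTransversal q 𝒢 ι)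
    {dP : ℕ} {P : Type*} [TopologicalSpace P] [ChartedSpace (EuclideanSpace ℝ (Fin dP)) P]
    [IsManifold (𝓡 dP) ∞ P]
    {dL : ℕ} {L : Type*} [TopologicalSpace L] [ChartedSpace (EuclideanSpace ℝ (Fin dL)) L]
    [IsManifold (𝓡 dL) ∞ L] {ℒ : LieGroupBundle n dL M L} :
    (∀ (B : Bitorsor dP ℒ 𝒦 P) (α : SectionOver q B ι),
      -- (i)
      (∀ β : GlobalSection B, Extends β α →
        IsExtIso (dK := dK) (dL := dL) (dG := dG) (dH := dG) X.toExtDiagram (X.twist B)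
          (conjMap β) (hatMap X β) ∧
        RestrictsToHat X α (hatMap X β) ∧ RestrictsToConj α (conjMap β)) ∧
      -- (ii)
      (∀ (v : K → L) (u : G → Twist X B.right),
        IsExtIso (dK := dK) (dL := dL) (dG := dG) (dH := dG) X.toExtDiagram (X.twist B) v u →
        RestrictsToHat X α u →
        ∃! β : GlobalSection B, Extends β α ∧ u = hatMap X β ∧ v = conjMap β)) ∧
    -- (iii)
    (∀ (B : Bitorsor dP 𝒦 𝒦 P) (α : SectionOver q B ι) (u : G → Twist X B.right),
      IsExtIso (dK := dK) (dL := dK) (dG := dG) (dH := dG) X.toExtDiagram (X.twist B) id u →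
      RestrictsToHat X α u → IsCentral α →
      ∀ β : GlobalSection B, Extends β α → u = hatMap X β → IsCentral β) := by 
  refine ⟨fun B α => ⟨fun β hβ => ⟨β.isExtIso X, fun a b g ha hb => ?_, fun a k hk => ?_⟩,
    fun v u h hα => ?_⟩, fun B α u h _ _ β _ hu x k hk => ?_⟩
  · exact Twist.mk_congr ((congrArg β.toFun hb).trans (hβ b)) rfl
      ((congrArg β.toFun ha).trans (hβ a)) (β.pr_toFun _) (β.pr_toFun _) _ _
  · have e : β.toFun (𝒦.src k) = α.toFun a := (congrArg β.toFun hk).trans (hβ a)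
    exact congrArg (fun p => B.left.div (B.right.act p k) p) e
  · obtain ⟨β, hβ, hu⟩ := h.exists_globalSection hι hα
    refine ⟨β, ⟨hβ, hu, eq_conjMap_of_isExtIso h hu⟩, fun β' h' => ?_⟩
    ext x
    obtain ⟨a, k, rfl, ht⟩ := hι.exists_arrow x
    have e := congrFun (h'.2.1.symm.trans hu) k
    rw [hatMap_eq_mk h'.1 ht, hatMap_eq_mk hβ ht] at e
    exact Twist.mk_right_injective _ _ _ e
  · -- Centrality of `β` is the equality `id = β̄` imposed by `u j = j_P`.
    have e := congrFun (eq_conjMap_of_isExtIso h hu) k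
    subst hk
    exact e.symm
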